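/- Let $n\ge 0$ and $r\ge 1$ be integers, let $\alpha\in\mathbb{R}$, and let $A\in M_n(\mathbb{C})$ be a positive semidefinite contraction, that is, a positive semidefinite Hermitian matrix whose Euclidean operator norm satisfies $\|A\|\le 1$. Suppose that every diagonal entry of $A$ is at most $\alpha$. Then $A$ has an $r$-paving with largest eigenvalue at most $4r^{-1/4}+\alpha$: there are pairwise disjoint (possibly empty) sets $S_1,\dots,S_r$ with $S_1\cup\dots\cup S_r=\{1,\dots,n\}$ such that for every $j\in\{1,\dots,r\}$ every eigenvalue of the principal submatrix $A(S_j)=(A_{kl})_{k,l\in S_j}$ is at most $$\frac{4}{r^{1/4}}+\alpha .$$ (An empty block has no eigenvalues.) -/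

import Mathlib

open scoped ComplexOrder

/-- An `r`-paving of an index set `ι`: a family of `r` pairwise disjoint subsets with union `ι`.
Blocks may be empty (they have to be when `r` exceeds the size of `ι`). -/
structure Paving (ι : Type*) [Fintype ι] [DecidableEq ι] (r : ℕ) where
  block : Fin r → Finset ι
  disjoint : ∀ j k, j ≠ k → Disjoint (block j) (block k)
  cover : ∀ i, ∃ j, i ∈ block j

/-- The principal submatrix `A(S)` with rows and columns indexed by `S`. -/
def principalBlock {ι : Type*} (A : Matrix ι ι ℂ) (S : Finset ι) : Matrix S S ℂ :=
  A.submatrix Subtype.val Subtype.val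

/-- A positive semidefinite (in particular Hermitian) matrix whose operator norm with respect to
the Euclidean norm on `ℂ^ι` is at most `1`. -/
def IsPSDContraction {ι : Type*} [Fintype ι] [DecidableEq ι] (A : Matrix ι ι ℂ) : Prop :=
  A.PosSemidef ∧ ‖Matrix.toEuclideanCLM (𝕜 := ℂ) A‖ ≤ 1

/-!
Placing `r` copies of `A` along the diagonal gives `1 ⊗ A`. A paving selects, for each index, one
of its `r` copies, and the blocks `A(S_j)` are then the diagonal blocks of the principal submatrix
of `1 ⊗ A` on the selected copies. The characteristic polynomials of these submatrices are summed
over all selections. Each partial sum is real stable in its variables, so at every stage the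
competing sums have a common interlacer, and some selection has largest root at most that of the
total sum.

The largest root of the total sum is bounded by a barrier argument. At a point `t > 1`, all
logarithmic derivatives are at most `φ = 1 / t + α / (t (t - 1))`, because `λ ↦ (t - λ)⁻¹` lies
below its chord on `[0, 1]`. Summing over one group of `r` copies lets the `r` coordinates of that
group move back by `δ`, as long as `r δ · r φ ≤ (r - 1)²`, without raising the logarithmic
derivatives in the other directions; this follows from partial fractions and the Cauchy–Schwarz
inequality for the roots. The choice `t = 1 + √r / 2` yields the bound `4 r ^ (-1/4) + α`.
-/

section CharacteristicMinors

open Matrix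

variable {τ : Type*} [DecidableEq τ]

theorem principalBlock_diagonal_sub (A : Matrix τ τ ℂ) (z : τ → ℂ) (B : Finset τ) :
    principalBlock (diagonal z - A) B = diagonal (fun i : B => z i) - principalBlock A B := by
  ext i j
  simp only [principalBlock, submatrix_apply, Matrix.sub_apply, diagonal_apply, Subtype.ext_iff]

theorem adjugate_principalBlock_self (M : Matrix τ τ ℂ) {B : Finset τ} {m : τ} (hm : m ∈ B) :
    (principalBlock M B).adjugate ⟨m, hm⟩ ⟨m, hm⟩ = (principalBlock M (B.erase m)).det := by
  let e : B.erase m ≃ {i : B // ¬ (i : τ) = m} :=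
    { toFun := fun i => ⟨⟨i, Finset.mem_of_mem_erase i.2⟩, Finset.ne_of_mem_erase i.2⟩
      invFun := fun i => ⟨i, Finset.mem_erase.2 ⟨i.2, i.1.2⟩⟩ }
  set N := (principalBlock M B).updateRow ⟨m, hm⟩ (Pi.single ⟨m, hm⟩ 1) with hN
  have pivot_block : N.toSquareBlockProp (fun i => (i : τ) = m) = 1 := by
    ext ⟨⟨i, _⟩, hi⟩ ⟨⟨j, _⟩, hj⟩
    obtain ⟨rfl, rfl⟩ : i = m ∧ j = m := ⟨hi, hj⟩
    simp [toSquareBlockProp, hN]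
  have complementary_block :
      (N.toSquareBlockProp fun i => ¬ (i : τ) = m).submatrix e e =
        principalBlock M (B.erase m) := by
    ext i j
    exact congrFun (updateRow_ne fun h => (e i).2 (congrArg Subtype.val h)) _
  rw [adjugate_apply, ← hN, twoBlockTriangular_det' N (fun i => (i : τ) = m), pivot_block,
    det_one, one_mul, ← complementary_block, det_submatrix_equiv_self]
  rintro ⟨i, _⟩ rfl j hj
  simp [hN, Subtype.ext_iff, hj]

/-- The characteristic minor `det (diag z - A)(B)`, with an independent variable for each row. -/
def charMinor (A : Matrix τ τ ℂ) (B : Finset τ) (z : τ → ℂ) : ℂ :=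
  (principalBlock (diagonal z - A) B).det

variable (A : Matrix τ τ ℂ)

theorem charMinor_congr {B : Finset τ} {z w : τ → ℂ} (h : ∀ i ∈ B, z i = w i) :
    charMinor A B z = charMinor A B w := by
  unfold charMinor
  congr 1
  ext i j
  simp [principalBlock, diagonal_apply, h i i.2]

theorem charMinor_add_single {B : Finset τ} {m : τ} (hm : m ∈ B) (z : τ → ℂ) (s : ℂ) :
    charMinor A B (z + Pi.single m s) = charMinor A B z + s * charMinor A (B.erase m) z := by
  have perturbed_row : principalBlock (diagonal (z + Pi.single m s) - A) B =
      (principalBlock (diagonal z - A) B).updateRow ⟨m, hm⟩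
        (principalBlock (diagonal z - A) B ⟨m, hm⟩ + s • Pi.single ⟨m, hm⟩ 1) := by
    ext i j
    obtain rfl | hi := eq_or_ne i ⟨m, hm⟩
    · obtain rfl | hj := eq_or_ne ⟨m, hm⟩ j
      · simp [principalBlock]
        ring
      · simp [principalBlock, hj, Subtype.coe_ne_coe.2 hj]
    · simp [principalBlock, hi, diagonal_apply, Pi.single_eq_of_ne (Subtype.coe_ne_coe.2 hi)]
  rw [charMinor, perturbed_row, det_updateRow_add, updateRow_eq_self, det_updateRow_smul,
    ← adjugate_apply, adjugate_principalBlock_self, charMinor, charMinor]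

end CharacteristicMinors

section MixedDeterminants

variable {τ : Type*} [DecidableEq τ]

theorem sdiff_erase_erase {B K : Finset τ} {j : τ} (hKB : K ⊆ B) (hj : j ∈ K) :
    (B \ K.erase j).erase j = B \ K := by
  rw [Finset.sdiff_erase (hKB hj), Finset.erase_insert fun h => (Finset.mem_sdiff.1 h).2 hj]

/-- The sum of the characteristic minors over the index sets obtained from `B` by thinning every
group in the list to a single element. For disjoint groups contained in `B` this is the mixed
characteristic polynomial whose roots interlace those of the individual minors. -/
def mixedDet (A : Matrix τ τ ℂ) (z : τ → ℂ) : List (Finset τ) → Finset τ → ℂ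
  | [], B => charMinor A B z
  | K :: V, B => ∑ j ∈ K, mixedDet A z V (B \ K.erase j)

variable (A : Matrix τ τ ℂ)

theorem mixedDet_congr {z w : τ → ℂ} (V : List (Finset τ)) {B : Finset τ}
    (h : ∀ i ∈ B, z i = w i) : mixedDet A z V B = mixedDet A w V B := by
  induction V generalizing B with
  | nil => exact charMinor_congr A h
  | cons K V ih =>
    exact Finset.sum_congr rfl fun j _ => ih fun i hi => h i (Finset.mem_sdiff.1 hi).1

theorem mixedDet_add_single {V : List (Finset τ)} {B : Finset τ} {m : τ} (hm : m ∈ B)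
    (hV : ∀ K ∈ V, m ∉ K) (z : τ → ℂ) (s : ℂ) :
    mixedDet A (z + Pi.single m s) V B = mixedDet A z V B + s * mixedDet A z V (B.erase m) := by
  induction V generalizing B with
  | nil => exact charMinor_add_single A hm z s
  | cons K V ih =>
    rw [List.forall_mem_cons] at hV
    simp only [mixedDet, Finset.mul_sum, ← Finset.sum_add_distrib, Finset.erase_sdiff_comm]
    exact Finset.sum_congr rfl fun j _ =>
      ih (Finset.mem_sdiff.2 ⟨hm, fun h => hV.1 (Finset.mem_of_mem_erase h)⟩) hV.2

theorem mixedDet_add_indicator {V : List (Finset τ)} {B L : Finset τ} (hL : L ⊆ B)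
    (hV : ∀ K ∈ V, Disjoint L K) (z : τ → ℂ) (s : ℂ) :
    mixedDet A (z + (L : Set τ).indicator fun _ => s) V B =
      ∑ S ∈ L.powerset, s ^ S.card * mixedDet A z V (B \ S) := by
  induction L using Finset.induction_on generalizing B with
  | empty => simp [← Pi.zero_def]
  | insert m L hm ih =>
    simp only [Finset.disjoint_insert_left] at hV
    have split_indicator : z + ((insert m L : Finset τ) : Set τ).indicator (fun _ => s) =
        z + (L : Set τ).indicator (fun _ => s) + Pi.single m s := by
      ext i
      obtain rfl | hi := eq_or_ne i m <;> simp [Set.indicator_apply, *]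
    have hLB : L ⊆ B.erase m := Finset.subset_erase.2 ⟨(Finset.subset_insert _ _).trans hL, hm⟩
    rw [split_indicator, mixedDet_add_single A (hL (Finset.mem_insert_self m L))
      fun K hK => (hV K hK).1, ih (hLB.trans (Finset.erase_subset _ _)) fun K hK => (hV K hK).2,
      ih hLB fun K hK => (hV K hK).2, Finset.sum_powerset_insert hm, Finset.mul_sum]
    congr 1
    refine Finset.sum_congr rfl fun S hS => ?_
    rw [Finset.card_insert_of_notMem fun h => hm (Finset.mem_powerset.1 hS h),
      Finset.sdiff_insert, Finset.erase_sdiff_comm]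
    ring

theorem mixedDet_cons_add_indicator {V : List (Finset τ)} {B L : Finset τ} (hL : L ⊆ B)
    (hV : ∀ K ∈ V, Disjoint L K) (z : τ → ℂ) (s : ℂ) :
    mixedDet A (z + (L : Set τ).indicator fun _ => s) (L :: V) B =
      mixedDet A z (L :: V) B + s * (L.card * mixedDet A z V (B \ L)) := by
  rw [← nsmul_eq_mul, ← Finset.sum_const, Finset.mul_sum, mixedDet, mixedDet,
    ← Finset.sum_add_distrib]
  refine Finset.sum_congr rfl fun j hj => ?_
  have hj' : j ∈ B \ L.erase j := by simp [hL hj]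
  rw [← sdiff_erase_erase hL hj,
    ← mixedDet_add_single A hj' fun K hK => Finset.disjoint_left.1 (hV K hK) hj]
  refine mixedDet_congr A V fun i hi => ?_
  obtain rfl | hij := eq_or_ne i j
  · simp [hj]
  · have : i ∉ L := fun h => (Finset.mem_sdiff.1 hi).2 (Finset.mem_erase.2 ⟨hij, h⟩)
    simp [this, hij]

theorem differentiable_mixedDet {z : ℂ → τ → ℂ} (hz : ∀ i, Differentiable ℂ fun w => z w i)
    (V : List (Finset τ)) (B : Finset τ) : Differentiable ℂ fun w => mixedDet A (z w) V B := by
  induction V generalizing B with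
  | nil =>
    simp only [mixedDet, charMinor, Matrix.det_apply']
    refine Differentiable.fun_sum fun σ _ => .const_mul (.fun_finsetProd fun i _ => ?_) _
    by_cases h : (σ i : τ) = i
    · simpa [principalBlock, h] using hz i
    · simp [principalBlock, h]
  | cons K V ih => exact Differentiable.fun_sum fun j _ => ih _

end MixedDeterminants

section Stability

open Matrix Filter Topology ComplexConjugate

variable {τ : Type*} [DecidableEq τ] {A : Matrix τ τ ℂ}

theorem det_diagonal_sub_ne_zero {κ : Type*} [Fintype κ] [DecidableEq κ] {M : Matrix κ κ ℂ}
    (hM : M.IsHermitian) {z : κ → ℂ} (hz : ∀ i, 0 < (z i).im) : (diagonal z - M).det ≠ 0 := by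
  intro hdet
  obtain ⟨v, hv, hMv⟩ := exists_mulVec_eq_zero_iff.2 hdet
  have im_form : ∑ i, (z i).im * Complex.normSq (v i) = 0 := by
    have form_eq_zero : (star v ⬝ᵥ (diagonal z - M) *ᵥ v).im = 0 := by rw [hMv]; simp
    rw [sub_mulVec, dotProduct_sub, Complex.sub_im, ← RCLike.im_eq_complex_im,
      hM.im_star_dotProduct_mulVec_self, sub_zero] at form_eq_zero
    rw [← form_eq_zero, dotProduct, RCLike.im_eq_complex_im, Complex.im_sum]
    refine Finset.sum_congr rfl fun i _ => ?_
    simp [mulVec_diagonal, Complex.normSq_apply]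
    ring
  refine hv (funext fun i => ?_)
  have := (Finset.sum_eq_zero_iff_of_nonneg fun j _ =>
    mul_nonneg (hz j).le (Complex.normSq_nonneg (v j))).1 im_form i (Finset.mem_univ i)
  simpa [(hz i).ne'] using this

theorem charMinor_ne_zero (hA : A.IsHermitian) (B : Finset τ) {z : τ → ℂ}
    (hz : ∀ i, 0 < (z i).im) : charMinor A B z ≠ 0 := by
  rw [charMinor, principalBlock_diagonal_sub]
  exact det_diagonal_sub_ne_zero (hA.submatrix _) fun i => hz i

theorem mul_normSq_le_im_mul_conj {F D : ℂ} {c : ℝ} (h : ∀ s : ℂ, 0 < c + s.im → F + s * D ≠ 0) :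
    c * Complex.normSq D ≤ (F * conj D).im := by
  obtain rfl | hD := eq_or_ne D 0
  · simp
  have root_im : c + (-(F / D)).im ≤ 0 := by
    by_contra! hs
    exact h _ hs (by field_simp; ring)
  have quotient_im : (F / D).im * Complex.normSq D = (F * conj D).im := by
    rw [div_eq_mul_inv, Complex.inv_def, ← mul_assoc, Complex.im_mul_ofReal, mul_assoc,
      inv_mul_cancel₀ (Complex.normSq_eq_zero.not.2 hD), mul_one]
  rw [Complex.neg_im] at root_im
  rw [← quotient_im]
  exact mul_le_mul_of_nonneg_right (by linarith) (Complex.normSq_nonneg D)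

/-- The hypothesis under which mixed determinants are real stable: the groups of `V` are nonempty,
pairwise disjoint and contained in `B`. -/
structure IsGrouping (V : List (Finset τ)) (B : Finset τ) : Prop where
  pairwise_disjoint : V.Pairwise Disjoint
  nonempty : ∀ K ∈ V, K.Nonempty
  subset : ∀ K ∈ V, K ⊆ B

namespace IsGrouping

variable {K L B : Finset τ} {V : List (Finset τ)}

theorem sdiff (h : IsGrouping V B) (hL : ∀ K ∈ V, Disjoint L K) : IsGrouping V (B \ L) :=
  ⟨h.pairwise_disjoint, h.nonempty, fun K hK =>
    Finset.subset_sdiff.2 ⟨h.subset K hK, (hL K hK).symm⟩⟩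

omit [DecidableEq τ] in
theorem tail (h : IsGrouping (K :: V) B) : IsGrouping V B :=
  ⟨h.pairwise_disjoint.of_cons, fun L hL => h.nonempty L (.tail _ hL),
    fun L hL => h.subset L (.tail _ hL)⟩

omit [DecidableEq τ] in
theorem disjoint_head (h : IsGrouping (K :: V) B) : ∀ L ∈ V, Disjoint K L := fun _ =>
  List.rel_of_pairwise_cons h.pairwise_disjoint

theorem tail_sdiff (h : IsGrouping (K :: V) B) (hL : L ⊆ K) : IsGrouping V (B \ L) :=
  h.tail.sdiff fun J hJ => (h.disjoint_head J hJ).mono_left hL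

end IsGrouping

variable {V : List (Finset τ)} {B L : Finset τ} {z : τ → ℂ} {m : τ}

theorem im_mul_normSq_mixedDet_erase_le_of_ne_zero (hm : m ∈ B) (hmV : ∀ K ∈ V, m ∉ K)
    (ne_zero : ∀ z : τ → ℂ, (∀ i, 0 < (z i).im) → mixedDet A z V B ≠ 0)
    (hz : ∀ i, 0 < (z i).im) :
    (z m).im * Complex.normSq (mixedDet A z V (B.erase m)) ≤
      (mixedDet A z V B * conj (mixedDet A z V (B.erase m))).im := by
  refine mul_normSq_le_im_mul_conj fun s hs => ?_
  rw [← mixedDet_add_single A hm hmV]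
  refine ne_zero _ fun i => ?_
  obtain rfl | hi := eq_or_ne i m
  · simpa using hs
  · simpa [hi] using hz i

theorem mixedDet_ne_zero (hA : A.IsHermitian) (hV : IsGrouping V B) (hz : ∀ i, 0 < (z i).im) :
    mixedDet A z V B ≠ 0 := by
  induction V generalizing B z with
  | nil => exact charMinor_ne_zero hA B hz
  | cons K V ih =>
    have hK : K ⊆ B := hV.subset K (.head _)
    have summand_im (j) (hj : j ∈ K) :
        0 < (mixedDet A z V (B \ K.erase j) * conj (mixedDet A z V (B \ K))).im := by
      rw [← sdiff_erase_erase hK hj]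
      refine (mul_pos (hz j) (Complex.normSq_pos.2 ?_)).trans_le
        (im_mul_normSq_mixedDet_erase_le_of_ne_zero (by simp [hK hj])
          (fun L hL => Finset.disjoint_left.1 (hV.disjoint_head L hL) hj)
          (fun w hw => ih (hV.tail_sdiff (K.erase_subset j)) hw) hz)
      rw [sdiff_erase_erase hK hj]
      exact ih (hV.tail_sdiff subset_rfl) hz
    intro h
    have sum_im := Finset.sum_pos summand_im (hV.nonempty K (.head _))
    rw [← Complex.im_sum, ← Finset.sum_mul, ← mixedDet, h, zero_mul, Complex.zero_im] at sum_im
    exact sum_im.false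

theorem im_mul_normSq_mixedDet_erase_le (hA : A.IsHermitian) (hV : IsGrouping V B) (hm : m ∈ B)
    (hmV : ∀ K ∈ V, m ∉ K) (hz : ∀ i, 0 ≤ (z i).im) :
    (z m).im * Complex.normSq (mixedDet A z V (B.erase m)) ≤
      (mixedDet A z V B * conj (mixedDet A z V (B.erase m))).im := by
  let shifted (ε : ℝ) : τ → ℂ := fun i => z i + ε * Complex.I
  have tendsto_mixedDet (C : Finset τ) :
      Tendsto (fun ε : ℝ => mixedDet A (shifted ε) V C) (𝓝[>] 0) (𝓝 (mixedDet A z V C)) := by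
    have cont : Continuous fun ε : ℝ => mixedDet A (shifted ε) V C :=
      (differentiable_mixedDet A (z := fun w i => z i + w * Complex.I) (fun i => by fun_prop)
        V C).continuous.comp Complex.continuous_ofReal
    simpa [shifted] using (cont.tendsto 0).mono_left nhdsWithin_le_nhds
  have tendsto_im : Tendsto (fun ε : ℝ => (shifted ε m).im) (𝓝[>] 0) (𝓝 (z m).im) := by
    have : Continuous fun ε : ℝ => (shifted ε m).im := by fun_prop
    simpa [shifted] using (this.tendsto 0).mono_left nhdsWithin_le_nhds
  refine le_of_tendsto_of_tendsto (tendsto_im.mul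
      ((Complex.continuous_normSq.tendsto _).comp (tendsto_mixedDet _)))
    ((Complex.continuous_im.tendsto _).comp ((tendsto_mixedDet B).mul
      ((Complex.continuous_conj.tendsto _).comp (tendsto_mixedDet _)))) ?_
  filter_upwards [self_mem_nhdsWithin] with ε (hε : 0 < ε)
  refine im_mul_normSq_mixedDet_erase_le_of_ne_zero hm hmV
    (fun w hw => mixedDet_ne_zero hA hV hw) fun i => ?_
  simpa [shifted] using add_pos_of_nonneg_of_pos (hz i) hε

theorem im_mul_norm_mixedDet_erase_le (hA : A.IsHermitian) (hV : IsGrouping V B) (hm : m ∈ B)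
    (hmV : ∀ K ∈ V, m ∉ K) (hz : ∀ i, 0 ≤ (z i).im) :
    (z m).im * ‖mixedDet A z V (B.erase m)‖ ≤ ‖mixedDet A z V B‖ := by
  obtain h | h := (norm_nonneg (mixedDet A z V (B.erase m))).eq_or_lt
  · simp [← h]
  refine le_of_mul_le_mul_right ?_ h
  calc (z m).im * ‖mixedDet A z V (B.erase m)‖ * ‖mixedDet A z V (B.erase m)‖
      = (z m).im * Complex.normSq (mixedDet A z V (B.erase m)) := by
        rw [Complex.normSq_eq_norm_sq]; ring
    _ ≤ _ := im_mul_normSq_mixedDet_erase_le hA hV hm hmV hz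
    _ ≤ ‖mixedDet A z V B * conj (mixedDet A z V (B.erase m))‖ :=
        (le_abs_self _).trans (Complex.abs_im_le_norm _)
    _ = _ := by simp

theorem prod_im_mul_norm_mixedDet_sdiff_le (hA : A.IsHermitian) (hV : IsGrouping V B) (hL : L ⊆ B)
    (hLV : ∀ K ∈ V, Disjoint L K) (hz : ∀ i, 0 ≤ (z i).im) :
    (∏ m ∈ L, (z m).im) * ‖mixedDet A z V (B \ L)‖ ≤ ‖mixedDet A z V B‖ := by
  induction L using Finset.induction_on with
  | empty => simp
  | insert m L hm ih =>
    simp only [Finset.disjoint_insert_left] at hLV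
    rw [Finset.insert_subset_iff] at hL
    have hV' : IsGrouping V (B \ L) := hV.sdiff fun K hK => (hLV K hK).2
    calc (∏ i ∈ insert m L, (z i).im) * ‖mixedDet A z V (B \ insert m L)‖
        = (∏ i ∈ L, (z i).im) * ((z m).im * ‖mixedDet A z V ((B \ L).erase m)‖) := by
          rw [Finset.prod_insert hm, Finset.sdiff_insert]; ring
      _ ≤ (∏ i ∈ L, (z i).im) * ‖mixedDet A z V (B \ L)‖ := by
          refine mul_le_mul_of_nonneg_left ?_ (Finset.prod_nonneg fun i _ => hz i)
          exact im_mul_norm_mixedDet_erase_le hA hV' (Finset.mem_sdiff.2 ⟨hL.1, hm⟩)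
            (fun K hK => (hLV K hK).1) hz
      _ ≤ _ := ih hL.2 fun K hK => (hLV K hK).2

theorem charMinor_conj (hA : A.IsHermitian) (B : Finset τ) (z : τ → ℂ) :
    charMinor A B (fun i => conj (z i)) = conj (charMinor A B z) := by
  rw [charMinor, charMinor, starRingEnd_apply, ← det_conjTranspose]
  congr 1
  ext i j
  simp only [principalBlock, conjTranspose_apply, submatrix_apply, Matrix.sub_apply, star_sub,
    hA.apply, diagonal_apply]
  split_ifs <;> simp_all

theorem mixedDet_conj (hA : A.IsHermitian) (z : τ → ℂ) (V : List (Finset τ)) (B : Finset τ) :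
    mixedDet A (fun i => conj (z i)) V B = conj (mixedDet A z V B) := by
  induction V generalizing B with
  | nil => exact charMinor_conj hA B z
  | cons K V ih => simp only [mixedDet, map_sum, ih]

end Stability

section SubsetPolynomials

open Polynomial

variable {τ R : Type*} [Semiring R]

/-- The generating polynomial `∑ f(S) X ^ #S` of a function on the subsets `S` of `L`. -/
noncomputable def subsetPoly (L : Finset τ) (f : Finset τ → R) : R[X] :=
  ∑ S ∈ L.powerset, monomial S.card (f S)

theorem coeff_subsetPoly (L : Finset τ) (f : Finset τ → R) (n : ℕ) :
    (subsetPoly L f).coeff n = ∑ S ∈ L.powersetCard n, f S := by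
  simp only [subsetPoly, finsetSum_coeff, coeff_monomial, Finset.powersetCard_eq_filter,
    Finset.sum_filter]

theorem natDegree_subsetPoly_le (L : Finset τ) (f : Finset τ → R) :
    (subsetPoly L f).natDegree ≤ L.card :=
  natDegree_sum_le_of_forall_le _ _ fun _ hS =>
    (natDegree_monomial_le _).trans (Finset.card_le_card (Finset.mem_powerset.1 hS))

theorem coeff_zero_subsetPoly (L : Finset τ) (f : Finset τ → R) :
    (subsetPoly L f).coeff 0 = f ∅ := by
  simp [coeff_subsetPoly]

theorem coeff_one_subsetPoly (L : Finset τ) (f : Finset τ → R) :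
    (subsetPoly L f).coeff 1 = ∑ m ∈ L, f {m} := by
  simp [coeff_subsetPoly, Finset.powersetCard_one]

theorem coeff_card_subsetPoly (L : Finset τ) (f : Finset τ → R) :
    (subsetPoly L f).coeff L.card = f L := by
  simp [coeff_subsetPoly]

theorem coeff_card_sub_one_subsetPoly [DecidableEq τ] {L : Finset τ} (hL : L.Nonempty)
    (f : Finset τ → R) : (subsetPoly L f).coeff (L.card - 1) = ∑ j ∈ L, f (L.erase j) := by
  have erase_injOn : Set.InjOn L.erase L := Finset.erase_injOn L
  rw [coeff_subsetPoly, ← Finset.sum_image erase_injOn]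
  refine Finset.sum_congr ?_ fun _ _ => rfl
  ext S
  rw [Finset.mem_image, ← Finset.covBy_iff_exists_erase, Finset.covBy_iff_card_sdiff_eq_one,
    Finset.mem_powersetCard]
  refine and_congr_right fun hS => ?_
  have := Finset.card_sdiff_add_card_eq_card hS
  have := hL.card_pos
  omega

end SubsetPolynomials

section Slices

open Polynomial Matrix

variable {τ : Type*} [DecidableEq τ]

/-- The real part of a mixed determinant at a real point. -/
def mixedRe (A : Matrix τ τ ℂ) (x : τ → ℝ) (V : List (Finset τ)) (B : Finset τ) : ℝ :=
  (mixedDet A (fun i => (x i : ℂ)) V B).re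

/-- The restriction of a mixed determinant to the line `x + w 1_L`, as a polynomial in `w`. -/
noncomputable def slice (A : Matrix τ τ ℂ) (x : τ → ℝ) (V : List (Finset τ)) (B L : Finset τ) :
    ℝ[X] :=
  subsetPoly L fun S => mixedRe A x V (B \ S)

theorem mixedRe_cons (A : Matrix τ τ ℂ) (x : τ → ℝ) (K : Finset τ) (V : List (Finset τ))
    (B : Finset τ) : mixedRe A x (K :: V) B = ∑ j ∈ K, mixedRe A x V (B \ K.erase j) :=
  Complex.re_sum _ _

theorem mixedRe_congr (A : Matrix τ τ ℂ) {x y : τ → ℝ} (V : List (Finset τ)) {B : Finset τ}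
    (h : ∀ i ∈ B, x i = y i) : mixedRe A x V B = mixedRe A y V B :=
  congrArg Complex.re (mixedDet_congr A V fun i hi => by rw [h i hi])

variable {A : Matrix τ τ ℂ} {V : List (Finset τ)} {B L : Finset τ} {x : τ → ℝ}

theorem ofReal_mixedRe (hA : A.IsHermitian) :
    (mixedRe A x V B : ℂ) = mixedDet A (fun i => (x i : ℂ)) V B := by
  refine Complex.conj_eq_iff_re.1 ?_
  simp only [← mixedDet_conj hA, Complex.conj_ofReal]

omit [DecidableEq τ] in
theorem ofReal_add_indicator (x : τ → ℝ) (L : Finset τ) (s : ℝ) :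
    (fun i => ((x + (L : Set τ).indicator fun _ => s) i : ℂ)) =
      (fun i => (x i : ℂ)) + (L : Set τ).indicator fun _ => (s : ℂ) := by
  classical
  ext i
  by_cases hi : i ∈ L <;> simp [hi]

theorem aeval_slice (hA : A.IsHermitian) (hL : L ⊆ B) (hV : ∀ K ∈ V, Disjoint L K) (w : ℂ) :
    aeval w (slice A x V B L) =
      mixedDet A ((fun i => (x i : ℂ)) + (L : Set τ).indicator fun _ => w) V B := by
  rw [mixedDet_add_indicator A hL hV, slice, subsetPoly, map_sum]
  refine Finset.sum_congr rfl fun S _ => ?_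
  rw [aeval_monomial, Complex.coe_algebraMap, ofReal_mixedRe hA, mul_comm]

theorem eval_slice (hA : A.IsHermitian) (hL : L ⊆ B) (hV : ∀ K ∈ V, Disjoint L K) (s : ℝ) :
    (slice A x V B L).eval s = mixedRe A (x + (L : Set τ).indicator fun _ => s) V B := by
  rw [← Complex.ofReal_inj, ofReal_mixedRe hA, ofReal_add_indicator, ← aeval_slice hA hL hV,
    ← Complex.coe_algebraMap, aeval_algebraMap_apply, coe_aeval_eq_eval]

theorem mixedRe_cons_eq_coeff_slice (hL : L ⊆ B) (hLne : L.Nonempty)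
    (hV : ∀ K ∈ V, Disjoint L K) (δ : ℝ) :
    mixedRe A x (L :: V) B =
      (slice A (x + (L : Set τ).indicator fun _ => δ) V B L).coeff (L.card - 1) -
        L.card * δ * (slice A (x + (L : Set τ).indicator fun _ => δ) V B L).coeff L.card := by
  have shift : mixedRe A (x + (L : Set τ).indicator fun _ => δ) (L :: V) B =
      mixedRe A x (L :: V) B + δ * (L.card * mixedRe A x V (B \ L)) := by
    rw [mixedRe, ofReal_add_indicator, mixedDet_cons_add_indicator A hL hV, Complex.add_re,
      Complex.re_ofReal_mul, ← Complex.ofReal_natCast, Complex.re_ofReal_mul, mixedRe, mixedRe]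
  have outside : mixedRe A (x + (L : Set τ).indicator fun _ => δ) V (B \ L) =
      mixedRe A x V (B \ L) :=
    mixedRe_congr A V fun i hi => by simp [(Finset.mem_sdiff.1 hi).2]
  rw [slice, coeff_card_sub_one_subsetPoly hLne, coeff_card_subsetPoly, ← mixedRe_cons, shift,
    outside]
  ring

theorem aeval_slice_ne_zero (hA : A.IsHermitian) (hV : IsGrouping V B) (hL : L ⊆ B)
    (hLV : ∀ K ∈ V, Disjoint L K) (lead : mixedRe A x V (B \ L) ≠ 0) {w : ℂ} (hw : 0 < w.im) :
    aeval w (slice A x V B L) ≠ 0 := by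
  set z : τ → ℂ := (fun i => (x i : ℂ)) + (L : Set τ).indicator fun _ => w with hz
  have im_nonneg (i) : 0 ≤ (z i).im := by
    by_cases hi : i ∈ L <;> simp [hz, hi, hw.le]
  have im_on (i) (hi : i ∈ L) : (z i).im = w.im := by simp [hz, hi]
  have lead_eq : mixedDet A z V (B \ L) = mixedRe A x V (B \ L) := by
    rw [ofReal_mixedRe hA]
    exact mixedDet_congr A V fun i hi => by simp [hz, (Finset.mem_sdiff.1 hi).2]
  have lower_bound := prod_im_mul_norm_mixedDet_sdiff_le hA hV hL hLV im_nonneg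
  rw [Finset.prod_congr rfl im_on, Finset.prod_const, lead_eq] at lower_bound
  rw [aeval_slice hA hL hLV, ← norm_pos_iff]
  exact (mul_pos (pow_pos hw _) (norm_pos_iff.2 (Complex.ofReal_ne_zero.2 lead))).trans_le
    lower_bound

end Slices

section ProperPosition

open Polynomial Filter Topology ComplexConjugate

/-- `g` is in proper position below `f`: the imaginary part of `f / g` is nonnegative on the open
upper half-plane. For real-rooted real polynomials this says that `g` interlaces `f`. Multiplying
through by `|g|²` avoids a side condition at the zeros of `g`. -/
def ProperPosition (g f : ℂ → ℂ) : Prop :=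
  ∀ w : ℂ, 0 < w.im → 0 ≤ (f w * conj (g w)).im

theorem exists_pow_eq_exp_mul_I {m : ℕ} {θ : ℝ} (hθ : 0 < θ) (hθm : θ < m * Real.pi) :
    ∃ ζ : ℂ, 0 < ζ.im ∧ ζ ^ m = Complex.exp (θ * Complex.I) := by
  have hm : 0 < (m : ℝ) := pos_of_mul_pos_left (hθ.trans hθm) Real.pi_pos.le
  refine ⟨Complex.exp ((θ / m : ℝ) * Complex.I), ?_, ?_⟩
  · rw [Complex.exp_ofReal_mul_I_im]
    exact Real.sin_pos_of_pos_of_lt_pi (by positivity) ((div_lt_iff₀' hm).2 hθm)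
  · rw [← Complex.exp_nat_mul]
    congr 1
    have : (m : ℂ) ≠ 0 := by exact_mod_cast hm.ne'
    push_cast
    field_simp

/-- Approach `a` along the direction `ζ`: the leading term of `f * conj q` dominates. -/
theorem im_pow_mul_eval_nonneg {q g : ℝ[X]} {a : ℝ} {m : ℕ}
    (h : ProperPosition (aeval · q) (aeval · ((X - C a) ^ m * g))) {ζ : ℂ} (hζ : 0 < ζ.im) :
    0 ≤ (ζ ^ m).im * (g.eval a * q.eval a) := by
  let F : ℝ → ℂ := fun ε => ζ ^ m * aeval (a + ε * ζ) g * conj (aeval (a + ε * ζ) q)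
  have F_zero : (F 0).im = (ζ ^ m).im * (g.eval a * q.eval a) := by
    have aeval_real (f : ℝ[X]) : aeval (a : ℂ) f = ((f.eval a : ℝ) : ℂ) :=
      aeval_ofReal f a
    simp only [F, Complex.ofReal_zero, zero_mul, add_zero, aeval_real, Complex.conj_ofReal]
    rw [mul_assoc, ← Complex.ofReal_mul, Complex.im_mul_ofReal]
  have F_tendsto : Tendsto (fun ε => (F ε).im) (𝓝[>] 0) (𝓝 (F 0).im) := by
    have : Continuous fun ε => (F ε).im := by fun_prop
    exact (this.tendsto 0).mono_left nhdsWithin_le_nhds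
  rw [← F_zero]
  refine ge_of_tendsto F_tendsto ?_
  filter_upwards [self_mem_nhdsWithin] with ε (hε : 0 < ε)
  have scaled := h (a + ε * ζ) (by simpa using mul_pos hε hζ)
  have : aeval ((a : ℂ) + ε * ζ) ((X - C a) ^ m * g) * conj (aeval ((a : ℂ) + ε * ζ) q) =
      (ε ^ m : ℝ) * F ε := by
    simp only [map_mul, map_pow, map_sub, aeval_X, aeval_C, Complex.coe_algebraMap, F]
    push_cast
    ring
  rw [this, Complex.im_ofReal_mul] at scaled
  exact nonneg_of_mul_nonneg_right scaled (pow_pos hε m)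

theorem rootMultiplicity_le_one {p q : ℝ[X]} (h : ProperPosition (aeval · q) (aeval · p))
    (hp : p ≠ 0) {a : ℝ} (hq : q.eval a ≠ 0) : p.rootMultiplicity a ≤ 1 := by
  obtain ⟨g, hpg, hg⟩ := exists_eq_pow_rootMultiplicity_mul_and_not_dvd p hp a
  set m := p.rootMultiplicity a
  by_contra! hm
  have hm' : (2 : ℝ) ≤ m := by exact_mod_cast hm
  have hg' : g.eval a ≠ 0 := fun h => hg (dvd_iff_isRoot.2 h)
  rw [hpg] at h
  obtain ⟨ζ, hζ, hζm⟩ := exists_pow_eq_exp_mul_I (m := m) (θ := Real.pi / 2) (by positivity)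
    (by nlinarith [Real.pi_pos])
  obtain ⟨ξ, hξ, hξm⟩ := exists_pow_eq_exp_mul_I (m := m) (θ := Real.pi / 2 + Real.pi)
    (by positivity) (by nlinarith [Real.pi_pos])
  have nonneg := im_pow_mul_eval_nonneg h hζ
  have nonpos := im_pow_mul_eval_nonneg h hξ
  rw [hζm, Complex.exp_ofReal_mul_I_im, Real.sin_pi_div_two] at nonneg
  rw [hξm, Complex.exp_ofReal_mul_I_im, Real.sin_add_pi, Real.sin_pi_div_two] at nonpos
  exact mul_ne_zero hg' hq (by linarith)

theorem ProperPosition.of_mul_X_sub_C {p q : ℝ[X]} {a : ℝ}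
    (h : ProperPosition (aeval · ((X - C a) * q)) (aeval · ((X - C a) * p))) :
    ProperPosition (aeval · q) (aeval · p) := by
  intro w hw
  have factor_pos : 0 < Complex.normSq (w - a) :=
    Complex.normSq_pos.2 fun h0 => hw.ne' (by simp [sub_eq_zero.1 h0])
  have : aeval w ((X - C a) * p) * conj (aeval w ((X - C a) * q)) =
      (Complex.normSq (w - a) : ℂ) * (aeval w p * conj (aeval w q)) := by
    simp only [Complex.normSq_eq_conj_mul_self, map_mul, map_sub, aeval_X, aeval_C,
      Complex.coe_algebraMap]
    ring
  have := this ▸ h w hw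
  rw [Complex.im_ofReal_mul] at this
  exact nonneg_of_mul_nonneg_right this factor_pos

end ProperPosition

section PartialFractions

open Polynomial Lagrange ComplexConjugate

variable {σ : Type*} [DecidableEq σ] {s : Finset σ} {a : σ → ℝ} {q : ℝ[X]}

omit [DecidableEq σ] in
theorem ProperPosition.injOn_nodal (h : ProperPosition (aeval · q) (aeval · (nodal s a)))
    (hq : ∀ i ∈ s, q.eval (a i) ≠ 0) : Set.InjOn a s := by
  classical
  intro i hi j hj hij
  by_contra hne
  have hj' : j ∈ s.erase i := Finset.mem_erase.2 ⟨Ne.symm hne, hj⟩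
  have double_root : (X - C (a i)) ^ 2 ∣ nodal s a := by
    rw [nodal_eq_mul_nodal_erase hi, sq]
    refine mul_dvd_mul_left _ ?_
    rw [hij]
    exact X_sub_C_dvd_nodal a hj'
  have nodal_ne := nodal_ne_zero (s := s) (v := a)
  have := (le_rootMultiplicity_iff nodal_ne).2 double_root
  have := rootMultiplicity_le_one h nodal_ne (hq i hi)
  omega

theorem ProperPosition.eval_mul_eval_nodal_erase_nonneg
    (h : ProperPosition (aeval · q) (aeval · (nodal s a))) {i : σ} (hi : i ∈ s) :
    0 ≤ q.eval (a i) * (nodal (s.erase i) a).eval (a i) := by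
  rw [nodal_eq_mul_nodal_erase hi, ← pow_one (X - C (a i))] at h
  simpa [mul_comm] using im_pow_mul_eval_nonneg h (ζ := Complex.I) (by simp)

theorem exists_eq_sum_nodal_erase_of_injOn (hdeg : q.degree < s.card)
    (h : ProperPosition (aeval · q) (aeval · (nodal s a))) (ha : Set.InjOn a s) :
    ∃ b : σ → ℝ, (∀ i, 0 ≤ b i) ∧ q = ∑ i ∈ s, C (b i) * nodal (s.erase i) a := by
  let b (i : σ) : ℝ := if i ∈ s then q.eval (a i) / (nodal (s.erase i) a).eval (a i) else 0
  refine ⟨b, fun i => ?_, ?_⟩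
  · unfold b
    split_ifs with hi
    · exact div_nonneg_iff.2 (mul_nonneg_iff.1 (h.eval_mul_eval_nodal_erase_nonneg hi))
    · rfl
  refine eq_of_degrees_lt_of_eval_index_eq s ha hdeg ?_ fun i hi => ?_
  · refine mem_degreeLT.1 (Submodule.sum_mem _ fun i hi => ?_)
    rw [← smul_eq_C_mul]
    refine Submodule.smul_mem _ _ (mem_degreeLT.2 ?_)
    rw [degree_nodal]
    exact_mod_cast Finset.card_erase_lt_of_mem hi
  · have others (j) (_ : j ∈ s) (hji : j ≠ i) : eval (a i) (C (b j) * nodal (s.erase j) a) = 0 := by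
      rw [eval_mul, eval_nodal_at_node (Finset.mem_erase.2 ⟨hji.symm, hi⟩), mul_zero]
    have pivot_ne : (nodal (s.erase i) a).eval (a i) ≠ 0 :=
      eval_nodal_not_at_node fun j hj => fun hij =>
        Finset.ne_of_mem_erase hj (ha (Finset.mem_of_mem_erase hj) hi hij.symm)
    rw [eval_finsetSum, Finset.sum_eq_single_of_mem i hi others, eval_mul, eval_C]
    simp [b, hi, pivot_ne]

/-- Partial fractions of `q / ∏ (X - a i)`; common roots are cancelled first, after which the nodes
are simple. -/
theorem ProperPosition.exists_eq_sum_nodal_erase (hdeg : q.degree < s.card)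
    (h : ProperPosition (aeval · q) (aeval · (nodal s a))) :
    ∃ b : σ → ℝ, (∀ i, 0 ≤ b i) ∧ q = ∑ i ∈ s, C (b i) * nodal (s.erase i) a := by
  induction s using Finset.strongInduction generalizing q with
  | H s ih =>
    by_cases hroot : ∃ i ∈ s, q.eval (a i) = 0
    · obtain ⟨i, hi, hqi⟩ := hroot
      obtain ⟨g, rfl⟩ := dvd_iff_isRoot.2 hqi
      rw [nodal_eq_mul_nodal_erase hi] at h
      have degree_g : g.degree < (s.erase i).card := by
        rw [degree_mul, degree_X_sub_C, ← Finset.card_erase_add_one hi, Nat.cast_add, Nat.cast_one,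
          add_comm] at hdeg
        exact lt_of_add_lt_add_right hdeg
      obtain ⟨b, hb, rfl⟩ := ih _ (Finset.erase_ssubset hi) degree_g h.of_mul_X_sub_C
      refine ⟨Function.update b i 0, fun j => ?_, ?_⟩
      · obtain rfl | hj := eq_or_ne j i <;> simp [*]
      rw [← Finset.add_sum_erase s _ hi, Finset.mul_sum]
      simp only [Function.update_self, C_0, zero_mul, zero_add]
      refine Finset.sum_congr rfl fun j hj => ?_
      have hij : i ∈ s.erase j := Finset.mem_erase.2 ⟨(Finset.ne_of_mem_erase hj).symm, hi⟩
      rw [Function.update_of_ne (Finset.ne_of_mem_erase hj), nodal_eq_mul_nodal_erase hij,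
        Finset.erase_right_comm]
      ring
    · push Not at hroot
      exact exists_eq_sum_nodal_erase_of_injOn hdeg h (h.injOn_nodal hroot)

end PartialFractions

section RealRooted

open Polynomial ComplexConjugate

theorem splits_of_aeval_ne_zero_of_im_pos {p : ℝ[X]} (h : ∀ w : ℂ, 0 < w.im → aeval w p ≠ 0) :
    p.Splits := by
  refine Splits.of_splits_map (algebraMap ℝ ℂ) (IsAlgClosed.splits _) fun w hw => ?_
  have root : aeval w p = 0 := by
    rw [← eval_map_algebraMap]
    exact (mem_roots'.1 hw).2
  refine ⟨w.re, Complex.conj_eq_iff_re.1 (Complex.conj_eq_iff_im.2 ?_)⟩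
  rcases lt_trichotomy w.im 0 with him | him | him
  · exact absurd (by rw [aeval_conj, root, map_zero]) (h (conj w) (by simpa using him))
  · exact him
  · exact absurd root (h w him)

end RealRooted

section BarrierShift

open Polynomial Lagrange ComplexConjugate

variable {σ : Type*} [DecidableEq σ] {s : Finset σ} {c d φ : ℝ}

theorem le_sum_erase_of_sum_inv_le {u : σ → ℝ} (hu : ∀ i ∈ s, 0 < u i) (hc : ∑ i ∈ s, (u i)⁻¹ ≤ c)
    (hd : d * c ≤ (s.card - 1) ^ 2) {j : σ} (hj : j ∈ s) : d ≤ ∑ i ∈ s.erase j, u i := by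
  have hu' (i) (hi : i ∈ s.erase j) : 0 < u i := hu i (Finset.mem_of_mem_erase hi)
  have cauchy_schwarz : ((s.card : ℝ) - 1) ^ 2 ≤
      (∑ i ∈ s.erase j, u i) * ∑ i ∈ s.erase j, (u i)⁻¹ := by
    have := Finset.sum_sq_le_sum_mul_sum_of_sq_le_mul (s.erase j)
      (r := fun _ => (1 : ℝ)) (f := u) (g := fun i => (u i)⁻¹)
      (fun i hi => (hu' i hi).le) (fun i hi => (inv_pos.2 (hu' i hi)).le)
      (fun i hi => by rw [one_pow, mul_inv_cancel₀ (hu' i hi).ne'])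
    rwa [Finset.sum_const, nsmul_one, Finset.cast_card_erase_of_mem hj] at this
  have sum_nonneg : 0 ≤ ∑ i ∈ s.erase j, u i := Finset.sum_nonneg fun i hi => (hu' i hi).le
  rw [← Finset.add_sum_erase s _ hj] at hc
  have head_inv_pos : 0 < (u j)⁻¹ := inv_pos.2 (hu j hj)
  have inv_sum_nonneg : 0 ≤ ∑ i ∈ s.erase j, (u i)⁻¹ :=
    Finset.sum_nonneg fun i hi => (inv_pos.2 (hu' i hi)).le
  refine le_of_mul_le_mul_right (hd.trans (cauchy_schwarz.trans ?_)) (by linarith : 0 < c)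
  exact mul_le_mul_of_nonneg_left (by linarith) sum_nonneg

variable {a : σ → ℝ}

omit [DecidableEq σ] in
theorem coeff_card_nodal (s : Finset σ) (a : σ → ℝ) : (nodal s a).coeff s.card = 1 := by
  simpa using (nodal_monic (s := s) (v := a)).coeff_natDegree

omit [DecidableEq σ] in
theorem coeff_card_sub_one_nodal (hs : s.Nonempty) (a : σ → ℝ) :
    (nodal s a).coeff (s.card - 1) = ∑ i ∈ s, -a i := by
  rw [nodal_eq, prod_X_sub_C_coeff_card_pred s a hs.card_pos, Finset.sum_neg_distrib]

omit [DecidableEq σ] in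
theorem coeff_zero_nodal_pos (ha : ∀ i ∈ s, a i < 0) : 0 < (nodal s a).coeff 0 := by
  rw [coeff_zero_eq_eval_zero, eval_nodal]
  exact Finset.prod_pos fun i hi => by linarith [ha i hi]

theorem coeff_zero_nodal_eq {i : σ} (hi : i ∈ s) :
    (nodal s a).coeff 0 = -a i * (nodal (s.erase i) a).coeff 0 := by
  rw [nodal_eq_mul_nodal_erase hi, mul_coeff_zero]
  simp

theorem coeff_one_nodal (s : Finset σ) (a : σ → ℝ) :
    (nodal s a).coeff 1 = ∑ i ∈ s, (nodal (s.erase i) a).coeff 0 := by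
  have := congrArg (coeff · 0) (derivative_nodal (s := s) (v := a))
  simpa [coeff_derivative, finsetSum_coeff] using this

omit [DecidableEq σ] in
theorem neg_le_coeff_card_sub_one_nodal_sub (ha : ∀ i ∈ s, a i < 0)
    (hc : (nodal s a).coeff 1 ≤ c * (nodal s a).coeff 0) (hd : d * c ≤ (s.card - 1) ^ 2)
    {i : σ} (hi : i ∈ s) : -a i ≤ (nodal s a).coeff (s.card - 1) - d := by
  classical
  have sum_inv_le : ∑ j ∈ s, (-a j)⁻¹ ≤ c := by
    refine le_of_mul_le_mul_right ?_ (coeff_zero_nodal_pos ha)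
    refine le_of_eq_of_le ?_ hc
    rw [coeff_one_nodal, Finset.sum_mul]
    refine Finset.sum_congr rfl fun j hj => ?_
    rw [coeff_zero_nodal_eq hj, inv_mul_cancel_left₀ (by linarith [ha j hj])]
  have := le_sum_erase_of_sum_inv_le (fun j hj => by linarith [ha j hj]) sum_inv_le hd hi
  rw [coeff_card_sub_one_nodal ⟨i, hi⟩, ← Finset.add_sum_erase s _ hi]
  linarith

theorem ProperPosition.exists_eq_C_mul_nodal_add_sum {q : ℝ[X]} (hq : q.natDegree ≤ s.card)
    (h : ProperPosition (aeval · q) (aeval · (nodal s a))) :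
    ∃ b : σ → ℝ, (∀ i, 0 ≤ b i) ∧
      q = C (q.coeff s.card) * nodal s a + ∑ i ∈ s, C (b i) * nodal (s.erase i) a := by
  set e := q.coeff s.card with he
  have degree_lt : (q - C e * nodal s a).degree < s.card := by
    rw [degree_lt_iff_coeff_zero]
    intro k hk
    obtain rfl | hlt := hk.eq_or_lt
    · simp [coeff_card_nodal, he]
    · rw [coeff_sub, coeff_C_mul, coeff_eq_zero_of_natDegree_lt (hq.trans_lt hlt),
        coeff_eq_zero_of_natDegree_lt (by rwa [natDegree_nodal]), mul_zero, sub_zero]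
  have remainder_position :
      ProperPosition (aeval · (q - C e * nodal s a)) (aeval · (nodal s a)) := by
    intro w hw
    have := h w hw
    simp only [map_sub, map_mul, aeval_C, Complex.coe_algebraMap, Complex.conj_ofReal, mul_sub,
      mul_left_comm _ (e : ℂ), Complex.mul_conj, Complex.sub_im, ← Complex.ofReal_mul,
      Complex.ofReal_im, sub_zero]
    exact this
  obtain ⟨b, hb, hsum⟩ := remainder_position.exists_eq_sum_nodal_erase degree_lt
  exact ⟨b, hb, by rw [← hsum]; ring⟩

omit [DecidableEq σ] in
theorem ProperPosition.coeff_card_sub_one_sub_le (hs : s.Nonempty) (ha : ∀ i ∈ s, a i < 0)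
    (hc : (nodal s a).coeff 1 ≤ c * (nodal s a).coeff 0) (hd : d * c ≤ (s.card - 1) ^ 2)
    {q : ℝ[X]} (hq : q.natDegree ≤ s.card) (h : ProperPosition (aeval · q) (aeval · (nodal s a)))
    (hφ : q.coeff 0 ≤ φ * (nodal s a).coeff 0) :
    q.coeff (s.card - 1) - d * q.coeff s.card ≤ φ * ((nodal s a).coeff (s.card - 1) - d) := by
  classical
  obtain ⟨b, hb, hsum⟩ := h.exists_eq_C_mul_nodal_add_sum hq
  set e := q.coeff s.card
  set N := nodal s a
  set S := N.coeff (s.card - 1) - d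
  have root_le (i) (hi : i ∈ s) : -a i ≤ S := neg_le_coeff_card_sub_one_nodal_sub ha hc hd hi
  have S_nonneg : 0 ≤ S := by
    obtain ⟨i, hi⟩ := hs
    linarith [ha i hi, root_le i hi]
  have coeff_zero : q.coeff 0 = e * N.coeff 0 + ∑ i ∈ s, b i * (nodal (s.erase i) a).coeff 0 := by
    conv_lhs => rw [hsum]
    simp only [coeff_add, coeff_C_mul, finsetSum_coeff]
  have coeff_pred : q.coeff (s.card - 1) = e * N.coeff (s.card - 1) + ∑ i ∈ s, b i := by
    conv_lhs => rw [hsum]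
    simp only [coeff_add, coeff_C_mul, finsetSum_coeff]
    refine congrArg _ (Finset.sum_congr rfl fun i hi => ?_)
    rw [← Finset.card_erase_of_mem hi, coeff_card_nodal, mul_one]
  have sum_le : ∑ i ∈ s, b i ≤ S * (φ - e) := by
    refine le_of_mul_le_mul_right ?_ (coeff_zero_nodal_pos ha)
    calc (∑ i ∈ s, b i) * N.coeff 0
        ≤ S * ∑ i ∈ s, b i * (nodal (s.erase i) a).coeff 0 := by
          rw [Finset.sum_mul, Finset.mul_sum]
          refine Finset.sum_le_sum fun i hi => ?_
          have := coeff_zero_nodal_pos fun j hj => ha j (Finset.mem_of_mem_erase (a := i) hj)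
          rw [coeff_zero_nodal_eq hi]
          nlinarith [mul_le_mul_of_nonneg_right (root_le i hi) (mul_nonneg (hb i) this.le)]
      _ ≤ S * (φ - e) * N.coeff 0 := by
          rw [mul_assoc]
          exact mul_le_mul_of_nonneg_left (by linarith) S_nonneg
  rw [coeff_pred]
  linear_combination sum_le

theorem exists_eq_C_leadingCoeff_mul_nodal {p : ℝ[X]} (hp : p.Splits) :
    ∃ a : Fin p.natDegree → ℝ, p = C p.leadingCoeff * nodal Finset.univ a := by
  have card_roots : Fintype.card p.roots = p.natDegree := by
    rw [Multiset.card_coe, hp.natDegree_eq_card_roots]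
  let e := Fintype.equivFinOfCardEq card_roots
  refine ⟨fun i => (e.symm i).1, ?_⟩
  conv_lhs => rw [hp.eq_prod_roots]
  rw [nodal_eq, e.symm.prod_comp fun i : p.roots => X - C i.1, Finset.prod_eq_multiset_prod,
    Multiset.map_univ p.roots fun x => X - C x]

theorem exists_neg_eq_C_leadingCoeff_mul_nodal {p : ℝ[X]}
    (hp : ∀ w : ℂ, 0 < w.im → aeval w p ≠ 0) (hpos : ∀ x, 0 ≤ x → 0 < p.eval x) :
    ∃ a : Fin p.natDegree → ℝ, (∀ i, a i < 0) ∧ p = C p.leadingCoeff * nodal Finset.univ a := by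
  obtain ⟨a, hpa⟩ := exists_eq_C_leadingCoeff_mul_nodal (splits_of_aeval_ne_zero_of_im_pos hp)
  refine ⟨a, fun i => ?_, hpa⟩
  by_contra! hi
  have := hpos (a i) hi
  rw [hpa, eval_mul, eval_nodal_at_node (Finset.mem_univ i), mul_zero] at this
  exact this.false

theorem ProperPosition.of_C_mul {p q : ℝ[X]} {k : ℝ} (hk : 0 < k)
    (h : ProperPosition (aeval · q) (aeval · (C k * p))) :
    ProperPosition (aeval · q) (aeval · p) := by
  intro w hw
  have scaled : 0 ≤ (aeval w (C k * p) * conj (aeval w q)).im := h w hw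
  rw [map_mul, aeval_C, Complex.coe_algebraMap, mul_assoc, Complex.im_ofReal_mul] at scaled
  exact nonneg_of_mul_nonneg_right scaled hk

theorem coeff_sub_pos_and_le_of_aeval_ne_zero {p : ℝ[X]} (hdeg : 0 < p.natDegree)
    (hlead : 0 < p.leadingCoeff) (hp : ∀ w : ℂ, 0 < w.im → aeval w p ≠ 0)
    (hpos : ∀ x, 0 ≤ x → 0 < p.eval x) (hc : p.coeff 1 ≤ c * p.coeff 0)
    (hd : d * c ≤ (p.natDegree - 1) ^ 2) :
    0 < p.coeff (p.natDegree - 1) - d * p.coeff p.natDegree ∧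
      ∀ q : ℝ[X], q.natDegree ≤ p.natDegree → ProperPosition (aeval · q) (aeval · p) →
        q.coeff 0 ≤ φ * p.coeff 0 →
          q.coeff (p.natDegree - 1) - d * q.coeff p.natDegree ≤
            φ * (p.coeff (p.natDegree - 1) - d * p.coeff p.natDegree) := by
  obtain ⟨a, root_neg, hpa⟩ := exists_neg_eq_C_leadingCoeff_mul_nodal hp hpos
  set N := nodal Finset.univ a
  have card_univ : (Finset.univ : Finset (Fin p.natDegree)).card = p.natDegree := by simp
  have coeff_eq (k : ℕ) : p.coeff k = p.leadingCoeff * N.coeff k := by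
    conv_lhs => rw [hpa, coeff_C_mul]
  have hcN : N.coeff 1 ≤ c * N.coeff 0 := by
    rw [coeff_eq, coeff_eq, mul_left_comm] at hc
    exact le_of_mul_le_mul_left hc hlead
  have hdN : d * c ≤ ((Finset.univ : Finset (Fin p.natDegree)).card - 1 : ℝ) ^ 2 := by
    rwa [card_univ]
  have shift_eq : p.coeff (p.natDegree - 1) - d * p.coeff p.natDegree =
      p.leadingCoeff * (N.coeff (p.natDegree - 1) - d) := by
    rw [coeff_eq (_ - 1), coeff_natDegree]
    ring
  rw [shift_eq]
  refine ⟨mul_pos hlead ?_, fun q hq h hφ => ?_⟩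
  · have := neg_le_coeff_card_sub_one_nodal_sub (fun i _ => root_neg i) hcN hdN
      (Finset.mem_univ ⟨0, hdeg⟩)
    rw [card_univ] at this
    linarith [root_neg ⟨0, hdeg⟩]
  · have := ProperPosition.coeff_card_sub_one_sub_le ⟨⟨0, hdeg⟩, Finset.mem_univ _⟩
      (fun i _ => root_neg i) hcN hdN (by rwa [card_univ]) ((hpa ▸ h).of_C_mul hlead)
      (φ := φ * p.leadingCoeff) (by rwa [coeff_eq, ← mul_assoc] at hφ)
    rwa [card_univ, mul_assoc] at this

end BarrierShift

section BaseBarrier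

open Matrix

section Resolvent

variable {κ : Type*} [DecidableEq κ] {M : Matrix κ κ ℂ} {t : ℝ}

theorem posDef_diagonal_sub (hM₁ : (1 - M).PosSemidef) {x : κ → ℝ} (hx : ∀ i, 1 < x i) :
    (diagonal (fun i => (x i : ℂ)) - M).PosDef := by
  have gap_posDef : (diagonal fun i => (x i - 1 : ℂ)).PosDef :=
    .diagonal fun i => by exact_mod_cast sub_pos.2 (hx i)
  convert gap_posDef.add_posSemidef hM₁ using 1
  rw [← diagonal_sub, diagonal_one]
  abel

/-- The chord of the convex function `λ ↦ (t - λ)⁻¹` on `[0, 1]`, evaluated at a matrix. -/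
noncomputable def resolventChord (t : ℝ) (M : Matrix κ κ ℂ) : Matrix κ κ ℂ :=
  t⁻¹ • (1 : Matrix κ κ ℂ) + (t * (t - 1))⁻¹ • M

theorem posDef_resolventChord (hM : M.PosSemidef) (ht : 1 < t) : (resolventChord t M).PosDef :=
  (PosDef.one.smul (by positivity)).add_posSemidef
    (hM.smul (inv_nonneg.2 (mul_nonneg (by linarith) (by linarith))))

variable [Fintype κ]

theorem posSemidef_sub_inv_comm {N : Matrix κ κ ℂ} (hM : M.PosDef) (hN : N.PosDef) :
    (M - N⁻¹).PosSemidef ↔ (N - M⁻¹).PosSemidef := by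
  have := hM.isUnit.invertible
  have := hN.isUnit.invertible
  have via_fromBlocks := (PosDef.fromBlocks₂₂ M 1 hN).symm.trans (PosDef.fromBlocks₁₁ 1 N hM)
  simpa only [conjTranspose_one, Matrix.one_mul, Matrix.mul_one] using via_fromBlocks

theorem resolventChord_mul_sub_mul_resolventChord (ht : 1 < t) :
    resolventChord t M * (t • 1 - M) * resolventChord t M = resolventChord t M +
      ((t ^ 2 * (t - 1))⁻¹ • (M - M * M) + ((t * (t - 1)) ^ 2)⁻¹ • (M * (1 - M) * M)) := by
  have : t - 1 ≠ 0 := by linarith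
  simp only [resolventChord, mul_add, add_mul, mul_sub, sub_mul, smul_mul_assoc, mul_smul_comm,
    one_mul, mul_one, mul_assoc, smul_sub, smul_add, smul_smul]
  match_scalars <;> field_simp <;> ring

theorem posSemidef_sub_inv_resolventChord (hM : M.PosSemidef) (hM₁ : (1 - M).PosSemidef)
    (ht : 1 < t) : (t • 1 - M - (resolventChord t M)⁻¹).PosSemidef := by
  set C := resolventChord t M with hC
  have C_posDef : C.PosDef := posDef_resolventChord hM ht
  have cube : (M * (1 - M) * M).PosSemidef := by
    simpa only [hM.1.eq] using hM₁.conjTranspose_mul_mul_same M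
  have square : (M - M * M).PosSemidef := by
    have := hM.conjTranspose_mul_mul_same (1 - M)
    rw [hM₁.1.eq] at this
    convert cube.add this using 1
    noncomm_ring
  have excess : (C * (t • 1 - M) * C - C).PosSemidef := by
    rw [hC, resolventChord_mul_sub_mul_resolventChord ht, add_sub_cancel_left]
    have : 0 < t - 1 := by linarith
    exact (square.smul (by positivity)).add (cube.smul (by positivity))
  have conj_inv := excess.conjTranspose_mul_mul_same C⁻¹
  have hdet := C_posDef.isUnit.map Matrix.detMonoidHom
  rw [C_posDef.1.inv.eq] at conj_inv
  convert conj_inv using 1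
  rw [mul_sub, sub_mul, nonsing_inv_mul C hdet, one_mul, ← mul_assoc, ← mul_assoc,
    nonsing_inv_mul C hdet, one_mul, mul_assoc, mul_nonsing_inv C hdet, mul_one]

theorem posSemidef_resolventChord_sub_inv (hM : M.PosSemidef) (hM₁ : (1 - M).PosSemidef)
    (ht : 1 < t) {x : κ → ℝ} (hx : ∀ i, t ≤ x i) :
    (resolventChord t M - (diagonal (fun i => (x i : ℂ)) - M)⁻¹).PosSemidef := by
  rw [posSemidef_sub_inv_comm (posDef_resolventChord hM ht)
    (posDef_diagonal_sub hM₁ fun i => ht.trans_le (hx i))]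
  have gap : (diagonal fun i => (x i - t : ℂ)).PosSemidef :=
    .diagonal fun i => show (0 : ℂ) ≤ _ by exact_mod_cast sub_nonneg.2 (hx i)
  convert gap.add (posSemidef_sub_inv_resolventChord hM hM₁ ht) using 1
  have : (t • 1 : Matrix κ κ ℂ) = diagonal fun _ => (t : ℂ) := by
    ext i j
    simp [one_apply, diagonal_apply]
  rw [← diagonal_sub, this]
  abel

theorem adjugate_diagonal_sub_apply_le (hM : M.PosSemidef) (hM₁ : (1 - M).PosSemidef)
    (ht : 1 < t) {x : κ → ℝ} (hx : ∀ i, t ≤ x i) (i : κ) :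
    (diagonal (fun i => (x i : ℂ)) - M).adjugate i i ≤
      (diagonal (fun i => (x i : ℂ)) - M).det * (t⁻¹ + (t * (t - 1))⁻¹ * M i i) := by
  have N_posDef := posDef_diagonal_sub hM₁ fun i => ht.trans_le (hx i)
  set N := diagonal (fun i => (x i : ℂ)) - M
  have adjugate_eq : N.adjugate i i = N.det * N⁻¹ i i := by
    rw [inv_def, Matrix.smul_apply, smul_eq_mul, Ring.inverse_eq_inv',
      mul_inv_cancel_left₀ N_posDef.det_pos.ne']
  have := (posSemidef_resolventChord_sub_inv hM hM₁ ht hx).diag_nonneg (i := i)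
  rw [Matrix.sub_apply, sub_nonneg] at this
  rw [adjugate_eq]
  refine mul_le_mul_of_nonneg_left (this.trans_eq ?_) N_posDef.det_pos.le
  simp [resolventChord]

end Resolvent

variable {τ : Type*} [DecidableEq τ] {A : Matrix τ τ ℂ}

theorem posSemidef_one_sub_principalBlock (hA₁ : (1 - A).PosSemidef) (B : Finset τ) :
    (1 - principalBlock A B).PosSemidef := by
  rw [← submatrix_one (Subtype.val : B → τ) Subtype.val_injective]
  exact hA₁.submatrix Subtype.val

theorem charMinor_pos (hA₁ : (1 - A).PosSemidef) (B : Finset τ) {x : τ → ℝ} (hx : ∀ i, 1 < x i) :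
    0 < charMinor A B fun i => (x i : ℂ) := by
  rw [charMinor, principalBlock_diagonal_sub]
  exact (posDef_diagonal_sub (posSemidef_one_sub_principalBlock hA₁ B) fun i => hx i).det_pos

theorem mixedRe_nil_pos (hA₁ : (1 - A).PosSemidef) (B : Finset τ) {x : τ → ℝ}
    (hx : ∀ i, 1 < x i) : 0 < mixedRe A x [] B :=
  (Complex.lt_def.1 (charMinor_pos hA₁ B hx)).1

theorem mixedRe_nil_erase_le (hA : A.PosSemidef) (hA₁ : (1 - A).PosSemidef) {t α : ℝ} (ht : 1 < t)
    (hα : ∀ i, (A i i).re ≤ α) {B : Finset τ} {m : τ} (hm : m ∈ B) {x : τ → ℝ}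
    (hx : ∀ i, t ≤ x i) :
    mixedRe A x [] (B.erase m) ≤ (1 / t + α / (t * (t - 1))) * mixedRe A x [] B := by
  have det_pos := charMinor_pos hA₁ B fun i => ht.trans_le (hx i)
  have chord_le : (t⁻¹ : ℝ) + (t * (t - 1) : ℝ)⁻¹ * A m m ≤ (1 / t + α / (t * (t - 1)) : ℝ) := by
    have diag_le : A m m ≤ (α : ℂ) :=
      Complex.le_def.2 ⟨hα m, (Complex.le_def.1 hA.diag_nonneg).2.symm⟩
    have inv_nonneg : (0 : ℂ) ≤ ((t * (t - 1) : ℝ) : ℂ)⁻¹ := by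
      exact_mod_cast inv_nonneg.2 (mul_nonneg (by linarith) (sub_nonneg.2 ht.le))
    rw [one_div, div_eq_inv_mul]
    push_cast at inv_nonneg ⊢
    gcongr
  have erase_le := adjugate_diagonal_sub_apply_le
    (show (principalBlock A B).PosSemidef from hA.submatrix _)
    (posSemidef_one_sub_principalBlock hA₁ B) ht (fun i => hx i) ⟨m, hm⟩
  rw [← principalBlock_diagonal_sub A (fun i => (x i : ℂ)), adjugate_principalBlock_self]
    at erase_le
  have := Complex.re_le_re (erase_le.trans (mul_le_mul_of_nonneg_left chord_le det_pos.le))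
  rwa [mul_comm, Complex.re_ofReal_mul] at this

end BaseBarrier

section MultivariateBarrier

open Polynomial Matrix

variable {τ : Type*} [DecidableEq τ] {A : Matrix τ τ ℂ} {x : τ → ℝ} {V : List (Finset τ)}
  {B K : Finset τ} {φ δ : ℝ}

/-- The point `x` lies beyond the zeros of a mixed determinant, and its logarithmic derivative there
in each ungrouped direction is at most `φ`. -/
structure BarrierLE (A : Matrix τ τ ℂ) (φ : ℝ) (x : τ → ℝ) (V : List (Finset τ))
    (B : Finset τ) : Prop where
  pos : 0 < mixedRe A x V B
  erase_le : ∀ m ∈ B, (∀ K ∈ V, m ∉ K) → mixedRe A x V (B.erase m) ≤ φ * mixedRe A x V B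

theorem coeff_zero_slice (A : Matrix τ τ ℂ) (x : τ → ℝ) (V : List (Finset τ)) (B K : Finset τ) :
    (slice A x V B K).coeff 0 = mixedRe A x V B := by
  rw [slice, coeff_zero_subsetPoly, Finset.sdiff_empty]

theorem coeff_one_slice (A : Matrix τ τ ℂ) (x : τ → ℝ) (V : List (Finset τ)) (B K : Finset τ) :
    (slice A x V B K).coeff 1 = ∑ m ∈ K, mixedRe A x V (B.erase m) := by
  simp only [slice, coeff_one_subsetPoly, Finset.sdiff_singleton_eq_erase]

theorem coeff_card_slice (A : Matrix τ τ ℂ) (x : τ → ℝ) (V : List (Finset τ)) (B K : Finset τ) :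
    (slice A x V B K).coeff K.card = mixedRe A x V (B \ K) :=
  coeff_card_subsetPoly K _

theorem natDegree_slice (lead : mixedRe A x V (B \ K) ≠ 0) :
    (slice A x V B K).natDegree = K.card :=
  natDegree_eq_of_le_of_coeff_ne_zero (natDegree_subsetPoly_le K _)
    ((coeff_card_slice A x V B K).trans_ne lead)

theorem properPosition_slice_erase (hA : A.IsHermitian) (hV : IsGrouping V B) (hK : K ⊆ B)
    (hKV : ∀ L ∈ V, Disjoint K L) {m : τ} (hm : m ∈ B) (hmK : m ∉ K) (hmV : ∀ L ∈ V, m ∉ L) :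
    ProperPosition (aeval · (slice A x V (B.erase m) K)) (aeval · (slice A x V B K)) := by
  intro w hw
  simp only [aeval_slice hA hK hKV, aeval_slice hA (Finset.subset_erase.2 ⟨hK, hmK⟩) hKV]
  refine (mul_nonneg ?_ (Complex.normSq_nonneg _)).trans
    (im_mul_normSq_mixedDet_erase_le hA hV hm hmV fun i => ?_)
  · simp [hmK]
  · by_cases hi : i ∈ K <;> simp [hi, hw.le]

theorem BarrierLE.cons (hA : A.IsHermitian) (hV : IsGrouping (K :: V) B)
    (hδ : K.card * δ * (K.card * φ) ≤ (K.card - 1) ^ 2)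
    (ray : ∀ s, 0 ≤ s → BarrierLE A φ (x + (K : Set τ).indicator fun _ => δ + s) V B)
    (lead : 0 < mixedRe A x V (B \ K)) : BarrierLE A φ x (K :: V) B := by
  set y := x + (K : Set τ).indicator fun _ => δ with hy
  have hK : K ⊆ B := hV.subset K (.head _)
  have K_nonempty : K.Nonempty := hV.nonempty K (.head _)
  have hKV := hV.disjoint_head
  have barrier : BarrierLE A φ y V B := by simpa using ray 0 le_rfl
  have lead_y : 0 < mixedRe A y V (B \ K) := by
    rwa [mixedRe_congr A V (y := x) fun i hi => by simp [hy, (Finset.mem_sdiff.1 hi).2]]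
  have degree : (slice A y V B K).natDegree = K.card := natDegree_slice lead_y.ne'
  have pos_on_ray (s : ℝ) (hs : 0 ≤ s) : 0 < (slice A y V B K).eval s := by
    rw [eval_slice hA hK hKV, hy, add_assoc, ← Set.indicator_add']
    exact (ray s hs).pos
  have coeff_one_le : (slice A y V B K).coeff 1 ≤ K.card * φ * (slice A y V B K).coeff 0 := by
    rw [coeff_one_slice, coeff_zero_slice, mul_assoc, ← nsmul_eq_mul]
    exact Finset.sum_le_card_nsmul _ _ _ fun m hm =>
      barrier.erase_le m (hK hm) fun L hL => Finset.disjoint_left.1 (hKV L hL) hm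
  obtain ⟨pos, transfer⟩ := coeff_sub_pos_and_le_of_aeval_ne_zero (φ := φ)
    (by rw [degree]; exact K_nonempty.card_pos)
    (by rwa [leadingCoeff, degree, coeff_card_slice])
    (fun w => aeval_slice_ne_zero hA hV.tail hK hKV lead_y.ne') pos_on_ray coeff_one_le
    (by rwa [degree])
  rw [degree] at pos transfer
  refine ⟨by rwa [mixedRe_cons_eq_coeff_slice hK K_nonempty hKV δ], fun m hm hmV => ?_⟩
  rw [List.forall_mem_cons] at hmV
  have hKm : K ⊆ B.erase m := Finset.subset_erase.2 ⟨hK, hmV.1⟩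
  rw [mixedRe_cons_eq_coeff_slice hK K_nonempty hKV δ,
    mixedRe_cons_eq_coeff_slice hKm K_nonempty hKV δ]
  refine transfer _ (natDegree_subsetPoly_le _ _)
    (properPosition_slice_erase hA hV.tail hK hKV hm hmV.1 hmV.2) ?_
  rw [coeff_zero_slice, coeff_zero_slice]
  exact barrier.erase_le m hm hmV.2

theorem barrierLE (hA : A.PosSemidef) (hA₁ : (1 - A).PosSemidef) {t α : ℝ} (ht : 1 < t)
    (hα : ∀ i, (A i i).re ≤ α) (hδ : 0 ≤ δ)
    (hV : IsGrouping V B) (hV' : ∀ K ∈ V,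
      K.card * δ * (K.card * (1 / t + α / (t * (t - 1)))) ≤ ((K.card : ℝ) - 1) ^ 2)
    (hx : ∀ i, t - δ ≤ x i) (hx' : ∀ i, (∀ K ∈ V, i ∉ K) → t ≤ x i) :
    BarrierLE A (1 / t + α / (t * (t - 1))) x V B := by
  induction V generalizing x B with
  | nil =>
    have above (i) : t ≤ x i := hx' i (by simp)
    exact ⟨mixedRe_nil_pos hA₁ B fun i => ht.trans_le (above i),
      fun m hm _ => mixedRe_nil_erase_le hA hA₁ ht hα hm above⟩
  | cons K V ih =>
    rw [List.forall_mem_cons] at hV'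
    have raised {B' : Finset τ} (hB' : IsGrouping V B') (s : ℝ) (hs : 0 ≤ s) :
        BarrierLE A (1 / t + α / (t * (t - 1)))
          (x + (K : Set τ).indicator fun _ => δ + s) V B' := by
      refine ih hB' hV'.2 (fun i => ?_) fun i hi => ?_ <;> by_cases hiK : i ∈ K
      · simp only [Pi.add_apply, Set.indicator_of_mem (Finset.mem_coe.2 hiK)]
        linarith [hx i]
      · simpa [hiK] using hx i
      · simp only [Pi.add_apply, Set.indicator_of_mem (Finset.mem_coe.2 hiK)]
        linarith [hx i]
      · simpa [hiK] using hx' i (by simpa [hiK] using hi)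
    refine .cons hA.1 hV hV'.1 (raised hV.tail) ?_
    rw [mixedRe_congr A V fun i hi => ?_]
    · exact (raised (hV.tail_sdiff subset_rfl) 0 le_rfl).pos
    · simp [(Finset.mem_sdiff.1 hi).2]

end MultivariateBarrier

section HalfLinePositivity

open Complex ComplexConjugate Filter Topology

variable {f d : ℂ → ℂ}

theorem ProperPosition.sum {ι : Type*} {s : Finset ι} {f : ι → ℂ → ℂ}
    (h : ∀ i ∈ s, ProperPosition d (f i)) : ProperPosition d fun w => ∑ i ∈ s, f i w := by
  intro w hw
  rw [Finset.sum_mul, im_sum]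
  exact Finset.sum_nonneg fun i hi => h i hi w hw

theorem ProperPosition.wronskian_nonneg (h : ProperPosition d f) {f' d' : ℂ} {x : ℝ}
    (hf : HasDerivAt f f' x) (hd : HasDerivAt d d' x) (hfx : (f x).im = 0) (hdx : (d x).im = 0) :
    0 ≤ f'.re * (d x).re - (f x).re * d'.re := by
  have vertical {g : ℂ → ℂ} {g' : ℂ} (hg : HasDerivAt g g' x) :
      HasDerivAt (fun ε : ℝ => g (x + ε * I)) (g' * I) 0 := by
    have line : HasDerivAt (fun ε : ℝ => (x : ℂ) + ε * I) I 0 := by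
      simpa using ((hasDerivAt_id (0 : ℝ)).ofReal_comp.mul_const I).const_add (x : ℂ)
    exact HasDerivAt.comp (0 : ℝ) (by simpa using hg) line
  have im_deriv := imCLM.hasFDerivAt.comp_hasDerivAt (0 : ℝ) ((vertical hf).mul (vertical hd).star)
  have := ge_of_tendsto im_deriv.tendsto_slope_zero_right (b := 0)
    (eventually_of_mem self_mem_nhdsWithin fun ε hε => by
      have := h (x + ε * I) (by simpa using hε)
      simpa [hfx, hdx, mul_im] using mul_nonneg (inv_nonneg.2 (le_of_lt hε)) this)
  simp only [imCLM_apply, add_im, mul_im, mul_re, ofReal_zero, zero_mul, add_zero, star_def,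
    conj_re, conj_im, I_re, I_im, hfx, hdx, mul_zero, mul_one] at this
  linarith

theorem ProperPosition.monotoneOn_re_div (h : ProperPosition d f) (hf : Differentiable ℂ f)
    (hd : Differentiable ℂ d) (hf_real : ∀ x : ℝ, (f x).im = 0) (hd_real : ∀ x : ℝ, (d x).im = 0)
    {s : Set ℝ} (hs : Convex ℝ s) (hpos : ∀ x ∈ s, 0 < (d x).re) :
    MonotoneOn (fun x : ℝ => (f x).re / (d x).re) s := by
  have quotient_deriv (x) (hx : x ∈ s) := (hf x).hasDerivAt.real_of_complex.div
    (hd x).hasDerivAt.real_of_complex (hpos x hx).ne'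
  refine monotoneOn_of_deriv_nonneg hs
    (fun x hx => (quotient_deriv x hx).continuousAt.continuousWithinAt)
    (fun x hx => (quotient_deriv x (interior_subset hx)).differentiableAt.differentiableWithinAt)
    fun x hx => ?_
  rw [HasDerivAt.deriv (f := fun x : ℝ => (f x).re / (d x).re)
    (quotient_deriv x (interior_subset hx))]
  exact div_nonneg (h.wronskian_nonneg (hf x).hasDerivAt (hd x).hasDerivAt (hf_real x) (hd_real x))
    (sq_nonneg _)

theorem exists_last_nonpos {g : ℝ → ℝ} (hg : Continuous g) (hev : ∀ᶠ x in atTop, 0 < g x) {x : ℝ}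
    (hx : g x ≤ 0) : ∃ y, x ≤ y ∧ g y ≤ 0 ∧ ∀ z, y < z → 0 < g z := by
  have bdd : BddAbove {y | g y ≤ 0} := by
    obtain ⟨T, hT⟩ := eventually_atTop.1 hev
    exact ⟨T, fun y hy => le_of_not_gt fun hlt => (hT y hlt.le).not_ge hy⟩
  refine ⟨sSup {y | g y ≤ 0}, le_csSup bdd hx,
    (isClosed_le hg continuous_const).csSup_mem ⟨x, hx⟩ bdd, fun z hz => ?_⟩
  by_contra! hle
  exact (le_csSup bdd hle).not_gt hz

theorem ProperPosition.re_pos_of_eventually (h : ProperPosition d f) (hf : Differentiable ℂ f)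
    (hd : Differentiable ℂ d) (hf_real : ∀ x : ℝ, (f x).im = 0) (hd_real : ∀ x : ℝ, (d x).im = 0)
    (hev : ∀ᶠ x : ℝ in atTop, 0 < (d x).re) {ρ : ℝ} (hpos : ∀ x : ℝ, ρ ≤ x → 0 < (f x).re) {x : ℝ}
    (hx : ρ ≤ x) : 0 < (d x).re := by
  by_contra! hneg
  have f_cont : Continuous fun x : ℝ => (f x).re :=
    continuous_re.comp (hf.continuous.comp continuous_ofReal)
  have d_cont : Continuous fun x : ℝ => (d x).re :=
    continuous_re.comp (hd.continuous.comp continuous_ofReal)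
  obtain ⟨last, x_le, last_nonpos, beyond⟩ := exists_last_nonpos d_cont hev hneg
  have cross_le (y) (hy : y ∈ Set.Ioo last (last + 1)) :
      (f y).re * (d ↑(last + 1)).re ≤ (f ↑(last + 1)).re * (d y).re := by
    rw [← div_le_div_iff₀ (beyond y hy.1) (beyond _ (lt_add_one last))]
    exact h.monotoneOn_re_div hf hd hf_real hd_real (convex_Ioi last) beyond hy.1 (lt_add_one last)
      hy.2.le
  have limit_le := le_of_tendsto_of_tendsto (b := 𝓝[>] last)
    (((f_cont.mul_const _).tendsto last).mono_left nhdsWithin_le_nhds)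
    (((d_cont.const_mul _).tendsto last).mono_left nhdsWithin_le_nhds)
    (eventually_of_mem (Ioo_mem_nhdsGT (lt_add_one last)) cross_le)
  have lhs_pos := mul_pos (hpos last (hx.trans x_le)) (beyond (last + 1) (lt_add_one last))
  have rhs_nonpos := mul_nonpos_of_nonneg_of_nonpos
    (hpos (last + 1) (by linarith)).le last_nonpos
  linarith

end HalfLinePositivity

section Selection

open Complex ComplexConjugate Filter

variable {τ : Type*} [DecidableEq τ] {A : Matrix τ τ ℂ} {V : List (Finset τ)} {B K : Finset τ}
  {ρ : ℝ}

theorem mixedRe_pos (hA₁ : (1 - A).PosSemidef) (hV : ∀ K ∈ V, K.Nonempty) (B : Finset τ)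
    {x : τ → ℝ} (hx : ∀ i, 1 < x i) : 0 < mixedRe A x V B := by
  induction V generalizing B with
  | nil => exact mixedRe_nil_pos hA₁ B hx
  | cons K V ih =>
    rw [List.forall_mem_cons] at hV
    rw [mixedRe_cons]
    exact Finset.sum_pos (fun j _ => ih hV.2 _) hV.1

theorem properPosition_mixedDet_sdiff_erase (hA : A.IsHermitian) (hV : IsGrouping (K :: V) B)
    {j : τ} (hj : j ∈ K) :
    ProperPosition (fun w => mixedDet A (fun _ => w) V (B \ K))
      (fun w => mixedDet A (fun _ => w) V (B \ K.erase j)) := by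
  intro w hw
  have hKB := hV.subset K (.head _)
  rw [← sdiff_erase_erase hKB hj]
  exact (mul_nonneg hw.le (normSq_nonneg _)).trans <|
    im_mul_normSq_mixedDet_erase_le hA (hV.tail_sdiff (K.erase_subset j)) (by simp [hKB hj])
      (fun L hL => Finset.disjoint_left.1 (hV.disjoint_head L hL) hj) fun _ => hw.le

theorem exists_mixedRe_sdiff_erase_pos (hA : A.IsHermitian) (hA₁ : (1 - A).PosSemidef)
    (hV : IsGrouping (K :: V) B) (hρ : ∀ x, ρ ≤ x → 0 < mixedRe A (fun _ => x) (K :: V) B) :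
    ∃ j ∈ K, ∀ x, ρ ≤ x → 0 < mixedRe A (fun _ => x) V (B \ K.erase j) := by
  have entire (V) (B : Finset τ) : Differentiable ℂ fun w => mixedDet A (fun _ => w) V B :=
    differentiable_mixedDet A (fun _ => differentiable_id) V B
  have real (V) (B : Finset τ) (x : ℝ) : (mixedDet A (fun _ => (x : ℂ)) V B).im = 0 := by
    rw [← ofReal_mixedRe (x := fun _ => x) hA, ofReal_im]
  have common_pos (x : ℝ) (hx : ρ ≤ x) : 0 < mixedRe A (fun _ => x) V (B \ K) :=
    ProperPosition.re_pos_of_eventually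
      (.sum fun j hj => properPosition_mixedDet_sdiff_erase hA hV hj) (entire (K :: V) B)
      (entire V _) (real (K :: V) B) (real V _)
      ((eventually_gt_atTop 1).mono fun y hy =>
        mixedRe_pos hA₁ hV.tail.nonempty (B \ K) (x := fun _ => y) fun _ => hy) hρ hx
  obtain ⟨j, hj, j_pos⟩ : ∃ j ∈ K, 0 < mixedRe A (fun _ => ρ) V (B \ K.erase j) := by
    refine Finset.exists_lt_of_sum_lt (f := fun _ => (0 : ℝ)) ?_
    rw [Finset.sum_const_zero, ← mixedRe_cons]
    exact hρ ρ le_rfl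
  refine ⟨j, hj, fun x hx => ?_⟩
  have quotient_le := (properPosition_mixedDet_sdiff_erase hA hV hj).monotoneOn_re_div
    (entire V _) (entire V _) (real V _) (real V _) (convex_Ici ρ) common_pos
    Set.self_mem_Ici hx hx
  exact (div_pos_iff_of_pos_right (common_pos x hx)).1
    ((div_pos j_pos (common_pos ρ le_rfl)).trans_le quotient_le)

theorem exists_transversal_mixedRe_pos (hA : A.IsHermitian) (hA₁ : (1 - A).PosSemidef)
    (hV : IsGrouping V B) (hρ : ∀ x, ρ ≤ x → 0 < mixedRe A (fun _ => x) V B) :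
    ∃ T ⊆ B, (∀ m ∈ B, (∀ K ∈ V, m ∉ K) → m ∈ T) ∧ (∀ K ∈ V, ∃ j, T ∩ K = {j}) ∧
      ∀ x, ρ ≤ x → 0 < mixedRe A (fun _ => x) [] T := by
  induction V generalizing B with
  | nil => exact ⟨B, subset_rfl, fun m hm _ => hm, by simp, hρ⟩
  | cons K V ih =>
    obtain ⟨j, hj, j_pos⟩ := exists_mixedRe_sdiff_erase_pos hA hA₁ hV hρ
    obtain ⟨T, hTB, ungrouped, transversal, T_pos⟩ := ih (hV.tail_sdiff (K.erase_subset j)) j_pos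
    refine ⟨T, hTB.trans Finset.sdiff_subset, fun m hm hmV => ?_, ?_, T_pos⟩
    · rw [List.forall_mem_cons] at hmV
      exact ungrouped m (by simp [hm, hmV.1]) hmV.2
    · refine List.forall_mem_cons.2 ⟨⟨j, ?_⟩, transversal⟩
      have hjT : j ∈ T := ungrouped j (by simp [hV.subset K (.head _) hj]) fun L hL =>
        Finset.disjoint_left.1 (hV.disjoint_head L hL) hj
      ext i
      have (hi : i ∈ T) (hiK : i ∈ K) : i = j := by
        by_contra hij
        exact (Finset.mem_sdiff.1 (hTB hi)).2 (Finset.mem_erase.2 ⟨hij, hiK⟩)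
      simp only [Finset.mem_inter, Finset.mem_singleton]
      exact ⟨fun h => this h.1 h.2, by rintro rfl; exact ⟨hjT, hj⟩⟩

end Selection

section Constants

theorem one_add_sub_mul_div_le {s α : ℝ} (hs : 0 < s) (hα : 0 ≤ α) :
    1 + s - (1 + s) * s / (s + α) ≤ α + 1 / (4 * s) := by
  have gap : α + 1 / (4 * s) - (1 + s - (1 + s) * s / (s + α)) =
      (s * (1 - 2 * α) ^ 2 + α) / (4 * s * (s + α)) := by
    field_simp
    ring
  rw [← sub_nonneg, gap]
  positivity

theorem one_add_sub_shift_le {s y α : ℝ} (hy : 0 < y) (hy₁ : y ≤ 1) (hs : s = 1 / (2 * y ^ 2))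
    (hα : 0 ≤ α) : 1 + s - (1 - y ^ 4) ^ 2 * ((1 + s) * s / (s + α)) ≤ 4 * y + α := by
  have s_pos : 0 < s := by rw [hs]; positivity
  set q := (1 + s) * s / (s + α) with hq
  have q_nonneg : 0 ≤ q := by positivity
  have q_le : q ≤ 1 + s := by
    rw [hq, div_le_iff₀ (by positivity)]
    exact mul_le_mul_of_nonneg_left (by linarith) (by positivity)
  have inv_s : 1 / (4 * s) = y ^ 2 / 2 := by rw [hs]; field_simp; norm_num
  have loss : y ^ 4 * (1 + s) = y ^ 4 + y ^ 2 / 2 := by rw [hs]; field_simp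
  calc 1 + s - (1 - y ^ 4) ^ 2 * q
      ≤ (1 + s - q) + 2 * (y ^ 4 * q) := by nlinarith [mul_nonneg (sq_nonneg (y ^ 4)) q_nonneg]
    _ ≤ (α + 1 / (4 * s)) + 2 * (y ^ 4 * (1 + s)) := by
        gcongr
        exact one_add_sub_mul_div_le s_pos hα
    _ = 2 * y ^ 4 + 3 / 2 * y ^ 2 + α := by rw [inv_s, loss]; ring
    _ ≤ 4 * y + α := by nlinarith [pow_le_of_le_one hy.le hy₁ (n := 4) (by norm_num),
        pow_le_of_le_one hy.le hy₁ (n := 2) (by norm_num)]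

theorem exists_barrier_shift {r α : ℝ} (hr : 1 ≤ r) (hα : 0 ≤ α) :
    ∃ t δ : ℝ, 1 < t ∧ 0 ≤ δ ∧ r * δ * (r * (1 / t + α / (t * (t - 1)))) ≤ (r - 1) ^ 2 ∧
      t - δ ≤ 4 * r ^ (-(1 / 4) : ℝ) + α := by
  have r_pos : 0 < r := by linarith
  set y := r ^ (-(1 / 4) : ℝ) with hy
  have y_pos : 0 < y := Real.rpow_pos_of_pos r_pos _
  have y_pow : y ^ 4 = 1 / r := by
    rw [hy, ← Real.rpow_mul_natCast r_pos.le]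
    norm_num [Real.rpow_neg_one]
  set s := 1 / (2 * y ^ 2) with hs
  have s_pos : 0 < s := by positivity
  refine ⟨1 + s, (1 - y ^ 4) ^ 2 * ((1 + s) * s / (s + α)), by linarith, by positivity, ?_,
    one_add_sub_shift_le y_pos (Real.rpow_le_one_of_one_le_of_nonpos hr (by norm_num)) hs hα⟩
  rw [y_pow, add_sub_cancel_left]
  refine le_of_eq ?_
  field_simp

end Constants

section Paving

open Matrix

theorem hasEigenvalue_of_submatrix {R m k : Type*} [CommRing R] [Fintype m] [DecidableEq m]
    [Fintype k] [DecidableEq k] {M : Matrix m m R} {e : k → m} (he : Function.Injective e)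
    (hM : ∀ i ∉ Set.range e, ∀ j, M i (e j) = 0) {μ : R}
    (h : Module.End.HasEigenvalue (toLin' (M.submatrix e e)) μ) :
    Module.End.HasEigenvalue (toLin' M) μ := by
  obtain ⟨v, hv⟩ := h.exists_hasEigenvector
  have mulVec_extend (i) : (M *ᵥ Function.extend e v 0) i = ∑ j, M i (e j) * v j := by
    refine (Fintype.sum_of_injective e he _ _ (fun j hj => ?_) fun j => ?_).symm
    · rw [Function.extend_apply' _ _ _ hj, Pi.zero_apply, mul_zero]
    · rw [he.extend_apply]
  refine Module.End.hasEigenvalue_of_hasEigenvector (x := Function.extend e v 0)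
    ⟨Module.End.mem_eigenspace_iff.2 (funext fun i => ?_), fun h0 => hv.2 (funext fun i => ?_)⟩
  · rw [toLin'_apply, mulVec_extend, Pi.smul_apply, smul_eq_mul]
    by_cases hi : i ∈ Set.range e
    · obtain ⟨i, rfl⟩ := hi
      rw [he.extend_apply]
      exact congrFun hv.apply_eq_smul i
    · simp [hM i hi, Function.extend_apply' _ _ _ hi]
  · rw [← he.extend_apply v 0, h0, Pi.zero_apply, Pi.zero_apply]

variable {ι τ : Type*} [DecidableEq ι] [DecidableEq τ]

theorem charMinor_eq_zero_of_hasEigenvalue {A : Matrix τ τ ℂ} {S : Finset τ} {μ : ℂ}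
    (h : Module.End.HasEigenvalue (toLin' (principalBlock A S)) μ) :
    charMinor A S (fun _ => μ) = 0 := by
  rw [Module.End.hasEigenvalue_iff_isRoot_charpoly, charpoly_toLin', Polynomial.IsRoot,
    eval_charpoly] at h
  rwa [charMinor, principalBlock_diagonal_sub]

open scoped Kronecker in
theorem hasEigenvalue_one_kronecker (A : Matrix ι ι ℂ) {T : Finset (τ × ι)} {l : τ} {S : Finset ι}
    (hS : ∀ i, i ∈ S ↔ (l, i) ∈ T) {μ : ℂ}
    (h : Module.End.HasEigenvalue (toLin' (principalBlock A S)) μ) :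
    Module.End.HasEigenvalue (toLin' (principalBlock ((1 : Matrix τ τ ℂ) ⊗ₖ A) T)) μ := by
  let e : S → T := fun i => ⟨(l, i), (hS i).1 i.2⟩
  have he : Function.Injective e := fun i j hij => Subtype.ext (by simpa [e] using hij)
  refine hasEigenvalue_of_submatrix he (fun ⟨⟨k, i⟩, hi⟩ hk j => ?_) ?_
  · have : k ≠ l := by
      rintro rfl
      exact hk ⟨⟨i, (hS i).2 hi⟩, rfl⟩
    simp [principalBlock, e, this]
  · have : (principalBlock ((1 : Matrix τ τ ℂ) ⊗ₖ A) T).submatrix e e = principalBlock A S := by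
      ext i j
      simp [principalBlock, e]
    rwa [this]

theorem mem_iff_of_inter_univ_product_singleton [Fintype τ] {T : Finset (τ × ι)} {i : ι}
    {j : τ × ι} (h : T ∩ Finset.univ ×ˢ {i} = {j}) (l : τ) : (l, i) ∈ T ↔ l = j.1 := by
  obtain ⟨c, k⟩ := j
  have mem_copies : (c, k) ∈ Finset.univ ×ˢ {i} :=
    Finset.mem_of_mem_inter_right (h ▸ Finset.mem_singleton_self (c, k))
  obtain rfl : i = k := by simpa using mem_copies
  simpa using Finset.ext_iff.1 h (l, i)

variable [Fintype ι] [Fintype τ]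

open scoped MatrixOrder Matrix.Norms.L2Operator in
theorem isPSDContraction_iff {A : Matrix ι ι ℂ} :
    IsPSDContraction A ↔ A.PosSemidef ∧ (1 - A).PosSemidef := by
  refine and_congr_right fun hA => ?_
  rw [← cstar_norm_def, CStarAlgebra.norm_le_one_iff_of_nonneg A hA.nonneg, le_iff]

theorem exists_transversal_eigenvalue_le {H : Matrix τ τ ℂ} (hH : IsPSDContraction H) {α : ℝ}
    (hα : ∀ i, (H i i).re ≤ α) {r : ℕ} (hr : 1 ≤ r) {V : List (Finset τ)}
    (hV : V.Pairwise Disjoint) (hcover : ∀ i, ∃ K ∈ V, i ∈ K) (hcard : ∀ K ∈ V, K.card = r) :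
    ∃ T : Finset τ, (∀ K ∈ V, ∃ j, T ∩ K = {j}) ∧ ∀ μ : ℝ,
      Module.End.HasEigenvalue (toLin' (principalBlock H T)) (μ : ℂ) →
        μ ≤ 4 * (r : ℝ) ^ (-(1 / 4) : ℝ) + α := by
  have grouping : IsGrouping V Finset.univ :=
    ⟨hV, fun K hK => Finset.card_pos.1 (hcard K hK ▸ hr), fun K _ => K.subset_univ⟩
  obtain _ | ⟨⟨i⟩⟩ := isEmpty_or_nonempty τ
  · exact ⟨∅, fun K hK => isEmptyElim (grouping.nonempty K hK).choose, fun μ hμ =>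
      (hμ.exists_hasEigenvector.choose_spec.2 (Subsingleton.elim _ _)).elim⟩
  obtain ⟨hH, hH₁⟩ := isPSDContraction_iff.1 hH
  have α_nonneg : 0 ≤ α := (Complex.le_def.1 (hH.diag_nonneg (i := i))).1.trans (hα i)
  obtain ⟨t, δ, ht, hδ, hδr, shift_le⟩ := exists_barrier_shift (r := r) (mod_cast hr) α_nonneg
  have barrier (x) (hx : t - δ ≤ x) : 0 < mixedRe H (fun _ => x) V Finset.univ :=
    (barrierLE hH hH₁ ht hα hδ grouping (fun K hK => by rwa [hcard K hK]) (fun _ => hx)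
      fun i hi => (hcover i).elim fun K hK => (hi K hK.1 hK.2).elim).pos
  obtain ⟨T, -, -, transversal, T_pos⟩ := exists_transversal_mixedRe_pos hH.1 hH₁ grouping barrier
  refine ⟨T, transversal, fun μ hμ => le_trans ?_ shift_le⟩
  by_contra! hlt
  refine (T_pos μ hlt.le).ne' ?_
  rw [mixedRe, mixedDet, charMinor_eq_zero_of_hasEigenvalue hμ, Complex.zero_re]

open scoped Kronecker in
theorem IsPSDContraction.one_kronecker {A : Matrix ι ι ℂ} (hA : IsPSDContraction A) :
    IsPSDContraction ((1 : Matrix τ τ ℂ) ⊗ₖ A) := by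
  rw [isPSDContraction_iff] at hA ⊢
  have complement : (1 : Matrix τ τ ℂ) ⊗ₖ (1 - A) = 1 - 1 ⊗ₖ A := by
    rw [eq_sub_iff_add_eq, ← kronecker_add, sub_add_cancel, one_kronecker_one]
  exact ⟨PosSemidef.one.kronecker hA.1, complement ▸ PosSemidef.one.kronecker hA.2⟩

end Paving

theorem mainTheorem4_general {ι : Type*} [Fintype ι] [DecidableEq ι] {r : ℕ} (hr : 1 ≤ r)
    {A : Matrix ι ι ℂ} (hA : IsPSDContraction A) {α : ℝ} (hα : ∀ i, (A i i).re ≤ α) :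
    ∃ P : Paving ι r, ∀ j : Fin r, ∀ μ : ℝ,
      Module.End.HasEigenvalue (Matrix.toLin' (principalBlock A (P.block j))) (μ : ℂ) →
        μ ≤ 4 * (r : ℝ) ^ (-(1 / 4) : ℝ) + α := by
  let copies (i : ι) : Finset (Fin r × ι) := Finset.univ ×ˢ {i}
  have copies_disjoint : (Finset.univ.toList.map copies).Pairwise Disjoint := by
    refine List.pairwise_map.2 ((Finset.nodup_toList _).imp fun hij => ?_)
    exact Finset.disjoint_product.2 (.inr (Finset.disjoint_singleton.2 hij))
  obtain ⟨T, transversal, T_le⟩ := exists_transversal_eigenvalue_le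
    (hA.one_kronecker (τ := Fin r)) (fun i => by simpa using hα i.2) hr copies_disjoint
    (by simp [copies]) (by simp [copies])
  choose kept hkept using fun i => transversal (copies i) (by simp)
  have mem_T (l i) : (l, i) ∈ T ↔ l = (kept i).1 :=
    mem_iff_of_inter_univ_product_singleton (hkept i) l
  refine ⟨⟨fun j => {i | j = (kept i).1}, fun j k hjk => ?_, fun i => ⟨(kept i).1, by simp⟩⟩,
    fun j μ hμ => T_le μ (hasEigenvalue_one_kronecker A (l := j) (fun i => ?_) hμ)⟩
  · exact Finset.disjoint_filter.2 fun i _ hij hik => hjk (hij.trans hik.symm)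
  · simp [mem_T]

theorem mainTheorem4 (n r : ℕ) (hr : 1 ≤ r) (A : Matrix (Fin n) (Fin n) ℂ)
    (hA : IsPSDContraction A) (α : ℝ) (hα : ∀ i, (A i i).re ≤ α) :
    ∃ P : Paving (Fin n) r, ∀ j : Fin r, ∀ μ : ℝ,
      Module.End.HasEigenvalue (Matrix.toLin' (principalBlock A (P.block j))) (μ : ℂ) →
        μ ≤ 4 * (r : ℝ) ^ (-(1 / 4) : ℝ) + α :=
  mainTheorem4_general hr hA hα
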